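/- **Pointed convex algebras.** A pointed convex algebra (PCA) is a set $X$ with an element $\star$ and binary operations $+_p$, $p\in(0,1)$, such that $(x_1+_qx_2)+_px_3=x_1+_{\tilde p}(x_2+_{\tilde q}x_3)$ with $\tilde p=pq$, $\tilde q=\frac{p(1-q)}{1-pq}$, and $x_1+_px_2=x_2+_{1-p}x_1$, and $x+_px=x$. One sets $x+_1y=x$, $x+_0y=y$ and $p\cdot x=x+_p\star$ for $p\in[0,1]$. A category is PCA-enriched if its homsets are PCAs and $e;(f+_pg)=(e;f)+_p(e;g)$, $(f+_pg);h=(f;h)+_p(g;h)$, $f;\star=\star=\star;f$. **Convex products.** In a PCA-enriched category, $(Z,\pi_1,\dots,\pi_n)$ with $\pi_i\colon Z\to X_i$ is a convex product of $X_1,\dots,X_n$ if for all $p_1,\dots,p_n\in[0,1]$ with $\sum_ip_i\le1$ and all $f_i\colon A\to X_i$ there is a unique $h\colon A\to Z$ with $h;\pi_i=p_i\cdot f_i$ for all $i$; this $h$ is denoted $\langle f_1,\dots,f_n\rangle_{\vec p}$. A convex biproduct category is a PCA-enriched category with an object $0$ that is initial and final and, for all $X_1,X_2$, an object $X_1\oplus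 X_2$ with arrows $\iota_i\colon X_i\to X_1\oplus X_2$ and $\pi_i\colon X_1\oplus X_2\to X_i$ such that $(X_1\oplus X_2,\iota_1,\iota_2)$ is a coproduct, $(X_1\oplus X_2,\pi_1,\pi_2)$ is a convex product, $\iota_i;\pi_i=\mathrm{id}_{X_i}$, and $\iota_i;\pi_j=\star$ for $i\ne j$. **The category $T(C)$.** Let $C$ be a category. Terms are generated by $$t::=\ \Delta^p_U\mid\ !_U\mid\underline c\mid\ ?_U\mid\nabla_U\mid\mathrm{id}_U\mid\mathrm{id}_0\mid\sigma_{U,V}\mid t;t\mid t\oplus t$$ with $p\in(0,1)$, $U,V$ objects and $c$ an arrow of $C$. Types are pairs $P\to Q$ of words over the objects of $C$ ($\oplus$ is concatenation, $0$ the empty word): $\Delta^p_U\colon U\to U\oplus U$, $!_U\colon U\to0$, $\underline c\colon U\to V$ for $c\colon U\to V$, $?_U\colon0\to U$, $\nabla_U\colon U\oplus U\to U$, $\mathrm{id}_U\colon U\to U$, $\mathrm{id}_0\colon0\to0$, $\sigma_{U,V}\colon U\oplus V\to V\oplus U$, with the usual rules for $;$ and $\oplus$; only typable terms are considered. Extend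 $\mathrm{id},!,?,\sigma$ to words in the evident inductive way, and put $\Delta^p_0=\nabla_0=\mathrm{id}_0$, $\Delta^p_{U\oplus P}=(\Delta^p_U\oplus\Delta^p_P);(\mathrm{id}_U\oplus\sigma_{U,P}\oplus\mathrm{id}_P)$, $\nabla_{U\oplus P}=(\mathrm{id}_U\oplus\sigma_{P,U}\oplus\mathrm{id}_P);(\nabla_U\oplus\nabla_P)$. The objects of $T(C)$ are the words; its arrows $P\to Q$ are the terms of type $P\to Q$ modulo the least congruence (for $;$ and $\oplus$) containing, for all words $P,Q$ and all typed terms $f\colon P\to Q$: - the axioms of strict symmetric monoidal categories for $(\oplus,0,\sigma)$; - $(\mathrm{id}_P\oplus\nabla_P);\nabla_P=(\nabla_P\oplus\mathrm{id}_P);\nabla_P$, $(?_P\oplus\mathrm{id}_P);\nabla_P=\mathrm{id}_P$, $\sigma_{P,P};\nabla_P=\nabla_P$, $?_0=\nabla_0=\mathrm{id}_0$, $?_{P\oplus Q}=?_P\oplus?_Q$, $\nabla_{P\oplus Q}=(\mathrm{id}_P\oplus\sigma_{Q,P}\oplus\mathrm{id}_Q);(\nabla_P\oplus\nabla_Q)$,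 $?_P;f=?_Q$, $\nabla_P;f=(f\oplus f);\nabla_Q$; - $\Delta^p_P;(\Delta^q_P\oplus\mathrm{id}_P)=\Delta^{\tilde p}_P;(\mathrm{id}_P\oplus\Delta^{\tilde q}_P)$, $\Delta^p_P;\nabla_P=\mathrm{id}_P$, $\Delta^p_P;\sigma_{P,P}=\Delta^{1-p}_P$, $\Delta^p_0=\,!_0=\mathrm{id}_0$, $!_{P\oplus Q}=\,!_P\oplus\,!_Q$, $\Delta^p_{P\oplus Q}=(\Delta^p_P\oplus\Delta^p_Q);(\mathrm{id}_P\oplus\sigma_{P,Q}\oplus\mathrm{id}_Q)$, $f;!_Q=\,!_P$, $f;\Delta^p_Q=\Delta^p_P;(f\oplus f)$; - $\underline{\mathrm{id}_U}=\mathrm{id}_U$ and $\underline{c;d}=\underline c;\underline d$. For $f,g\colon P\to Q$ in $T(C)$ put $f+_pg=\Delta^p_P;(f\oplus g);\nabla_Q$ and $\star_{P,Q}=\,!_P;?_Q$. Put $\Delta^0_P=?_P\oplus\mathrm{id}_P$ and $\Delta^1_P=\mathrm{id}_P\oplus?_P$, and for $p_1,\dots,p_n\in[0,1]$ with $\sum_ip_i\le1$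 define $\Delta^{\vec p}_{P,n}\colon P\to\bigoplus_{i=1}^nP$ by $\Delta^{()}_{P,0}=\,!_P$ and $\Delta^{\vec p}_{P,n+1}=\Delta^{p_1}_P;(\mathrm{id}_P\oplus\Delta^{\vec q}_{P,n})$, where $q_i=\frac{p_{i+1}}{1-p_1}$ if $p_1\ne1$ and $q_i=0$ if $p_1=1$. **Theorem.** For every category $C$, the category $T(C)$, with the operations $+_p,\star$, the object $0$, the objects $P_1\oplus P_2$, the injections $\iota_1=\mathrm{id}_{P_1}\oplus?_{P_2}$, $\iota_2=?_{P_1}\oplus\mathrm{id}_{P_2}$ and the projections $\pi_1=\mathrm{id}_{P_1}\oplus\,!_{P_2}$, $\pi_2=\,!_{P_1}\oplus\mathrm{id}_{P_2}$, is a convex biproduct category. Moreover, for all words $Q_1,\dots,Q_n$, the word $\bigoplus_{i=1}^nQ_i$ with the projections $\pi_i=\,!_{\bigoplus_{j<i}Q_j}\oplus\mathrm{id}_{Q_i}\oplus\,!_{\bigoplus_{j>i}Q_j}$ is a convex product of $Q_1,\dots,Q_n$, and for all $p_1,\dots,p_n\in[0,1]$ with $\sum_ip_i\le1$, every word $P$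 and all arrows $t_i\colon P\to Q_i$, $$\langle t_1,\dots,t_n\rangle_{\vec p}=\Delta^{\vec p}_{P,n};\bigoplus_{i=1}^nt_i .$$ In particular this holds when $P=U$ and $Q_i=U_i$ are single objects of $C$. -/

import Mathlib

open CategoryTheory CategoryTheory.Limits

universe u v w

noncomputable section

namespace ProbTape

/-! ### Pointed convex algebras -/

/-- The open real interval `(0,1)`. -/
abbrev OpenUnit : Type := Set.Ioo (0 : ℝ) 1

namespace OpenUnit

/-- `1 - p`. -/
def compl (p : OpenUnit) : OpenUnit :=
  ⟨1 - p.1, by have h := p.2; constructor <;> linarith [h.1, h.2]⟩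

theorem mul_mem (p q : OpenUnit) : p.1 * q.1 ∈ Set.Ioo (0 : ℝ) 1 := by
  obtain ⟨p, hp⟩ := p
  obtain ⟨q, hq⟩ := q
  exact ⟨mul_pos hp.1 hq.1, by nlinarith [hp.1, hp.2, hq.1, hq.2]⟩

/-- `p̃ = p q`. -/
def tildeP (p q : OpenUnit) : OpenUnit := ⟨p.1 * q.1, mul_mem p q⟩

/-- `q̃ = p (1 - q) / (1 - p q)`. -/
def tildeQ (p q : OpenUnit) : OpenUnit :=
  ⟨p.1 * (1 - q.1) / (1 - p.1 * q.1), by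
    have h := mul_mem p q
    obtain ⟨p, hp⟩ := p
    obtain ⟨q, hq⟩ := q
    have h1 : 0 < 1 - p * q := by linarith [h.2]
    refine ⟨div_pos (mul_pos hp.1 (by linarith [hq.2])) h1, ?_⟩
    rw [div_lt_one h1]
    nlinarith [hp.2]⟩

end OpenUnit

/-- The operations of a pointed convex algebra: a point `star` and, for every `p ∈ (0,1)`, a binary
operation `conv p`, written `x +_p y` in the comments. -/
structure PCAOps (X : Type w) where
  star : X
  conv : OpenUnit → X → X → X

namespace PCAOps

variable {X : Type w}

/-- The laws of a pointed convex algebra. -/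
structure IsPCA (A : PCAOps X) : Prop where
  assoc : ∀ (p q : OpenUnit) (x₁ x₂ x₃ : X),
    A.conv p (A.conv q x₁ x₂) x₃ =
      A.conv (OpenUnit.tildeP p q) x₁ (A.conv (OpenUnit.tildeQ p q) x₂ x₃)
  comm : ∀ (p : OpenUnit) (x₁ x₂ : X), A.conv p x₁ x₂ = A.conv p.compl x₂ x₁
  idem : ∀ (p : OpenUnit) (x : X), A.conv p x x = x

open Classical in
/-- The operation `x +_p y` for `p ∈ [0,1]`, where `x +_1 y = x` and `x +_0 y = y`.
(It is only used for `p ∈ [0,1]`.) -/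
def convI (A : PCAOps X) (p : ℝ) (x y : X) : X :=
  if h : p ∈ Set.Ioo (0 : ℝ) 1 then A.conv ⟨p, h⟩ x y else if p = 0 then y else x

/-- Multiplication by a scalar `p ∈ [0,1]`: `p · x = x +_p ⋆`. -/
def scale (A : PCAOps X) (p : ℝ) (x : X) : X := A.convI p x A.star

end PCAOps

/-! ### Enrichment, convex products and convex biproduct categories -/

section Enriched

variable {D : Type u} [Category.{v} D]

/-- A choice of operations of a pointed convex algebra on every homset of `D`. -/
abbrev HomOps (D : Type u) [Category.{v} D] := ∀ X Y : D, PCAOps (X ⟶ Y)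

/-- `D`, with the operations `H` on its homsets, is a category enriched over pointed convex
algebras. -/
structure IsPCAEnriched (H : HomOps D) : Prop where
  isPCA : ∀ X Y : D, (H X Y).IsPCA
  comp_conv : ∀ (p : OpenUnit) {X Y Z : D} (e : X ⟶ Y) (f g : Y ⟶ Z),
    e ≫ (H Y Z).conv p f g = (H X Z).conv p (e ≫ f) (e ≫ g)
  conv_comp : ∀ (p : OpenUnit) {X Y Z : D} (f g : X ⟶ Y) (h : Y ⟶ Z),
    (H X Y).conv p f g ≫ h = (H X Z).conv p (f ≫ h) (g ≫ h)
  comp_star : ∀ {X Y : D} (Z : D) (f : X ⟶ Y), f ≫ (H Y Z).star = (H X Z).star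
  star_comp : ∀ (X : D) {Y Z : D} (f : Y ⟶ Z), (H X Y).star ≫ f = (H X Z).star

/-- `(Z, π₁, π₂)` is a convex product of `X₁` and `X₂`. -/
def IsConvexProduct (H : HomOps D) {Z X₁ X₂ : D} (π₁ : Z ⟶ X₁) (π₂ : Z ⟶ X₂) : Prop :=
  ∀ p₁ p₂ : ℝ, p₁ ∈ Set.Icc (0 : ℝ) 1 → p₂ ∈ Set.Icc (0 : ℝ) 1 → p₁ + p₂ ≤ 1 →
    ∀ (A : D) (f : A ⟶ X₁) (g : A ⟶ X₂),
      ∃! h : A ⟶ Z, h ≫ π₁ = (H A X₁).scale p₁ f ∧ h ≫ π₂ = (H A X₂).scale p₂ g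

/-- `(Z, π₁, …, πₙ)` is a convex product of `X₁, …, Xₙ`. -/
def IsNaryConvexProduct (H : HomOps D) {n : ℕ} {X : Fin n → D} {Z : D} (π : ∀ i, Z ⟶ X i) : Prop :=
  ∀ p : Fin n → ℝ, (∀ i, p i ∈ Set.Icc (0 : ℝ) 1) → ∑ i, p i ≤ 1 →
    ∀ (A : D) (f : ∀ i, A ⟶ X i), ∃! h : A ⟶ Z, ∀ i, h ≫ π i = (H A (X i)).scale (p i) (f i)

/-- The convex pairing `⟨f₁, …, fₙ⟩_p`: the unique mediating arrow into an `n`-ary convex product. -/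
def IsNaryConvexProduct.pairing {H : HomOps D} {n : ℕ} {X : Fin n → D} {Z : D}
    {π : ∀ i, Z ⟶ X i} (hπ : IsNaryConvexProduct H π) (p : Fin n → ℝ)
    (hp : ∀ i, p i ∈ Set.Icc (0 : ℝ) 1) (hsum : ∑ i, p i ≤ 1) {A : D} (f : ∀ i, A ⟶ X i) : A ⟶ Z :=
  (hπ p hp hsum A f).choose

/-- The data of a convex biproduct category on a category `D`. -/
structure ConvexBiproductData (D : Type u) [Category.{v} D] where
  homOps : HomOps D
  zero : D
  oplus : D → D → D
  π₁ : ∀ X₁ X₂ : D, oplus X₁ X₂ ⟶ X₁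
  π₂ : ∀ X₁ X₂ : D, oplus X₁ X₂ ⟶ X₂
  ι₁ : ∀ X₁ X₂ : D, X₁ ⟶ oplus X₁ X₂
  ι₂ : ∀ X₁ X₂ : D, X₂ ⟶ oplus X₁ X₂

/-- `D` with the data `B` is a convex biproduct category. -/
structure IsConvexBiproductCategory (B : ConvexBiproductData D) : Prop where
  enriched : IsPCAEnriched B.homOps
  isInitial : Nonempty (IsInitial B.zero)
  isFinal : Nonempty (IsTerminal B.zero)
  isCoproduct : ∀ X₁ X₂ : D, Nonempty (IsColimit (BinaryCofan.mk (B.ι₁ X₁ X₂) (B.ι₂ X₁ X₂)))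
  isConvexProduct : ∀ X₁ X₂ : D, IsConvexProduct B.homOps (B.π₁ X₁ X₂) (B.π₂ X₁ X₂)
  ι₁_π₁ : ∀ X₁ X₂ : D, B.ι₁ X₁ X₂ ≫ B.π₁ X₁ X₂ = 𝟙 X₁
  ι₂_π₂ : ∀ X₁ X₂ : D, B.ι₂ X₁ X₂ ≫ B.π₂ X₁ X₂ = 𝟙 X₂
  ι₁_π₂ : ∀ X₁ X₂ : D, B.ι₁ X₁ X₂ ≫ B.π₂ X₁ X₂ = (B.homOps X₁ X₂).star
  ι₂_π₁ : ∀ X₁ X₂ : D, B.ι₂ X₁ X₂ ≫ B.π₁ X₁ X₂ = (B.homOps X₂ X₁).star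

end Enriched

/-! ### Terms and their typing -/

/-- Raw terms over a category `C`; `comp` is sequential composition `;` (in diagrammatic order)
and `sum` is the monoidal product `⊕`. -/
inductive Term (C : Type u) [Category.{v} C] : Type (max u v)
  | diag (p : OpenUnit) (U : C) : Term C
  | bang (U : C) : Term C
  | tape {U V : C} (c : U ⟶ V) : Term C
  | cobang (U : C) : Term C
  | codiag (U : C) : Term C
  | idLetter (U : C) : Term C
  | idZero : Term C
  | swap (U V : C) : Term C
  | comp (t s : Term C) : Term C
  | sum (t s : Term C) : Term C

variable {C : Type u} [Category.{v} C]

/-- `HasType t P Q`: the term `t` has type `P → Q`. Words `P, Q` are lists of objects of `C`, the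
word `P ⊕ Q` is `P ++ Q` and the word `0` is `[]`. -/
inductive HasType : Term C → List C → List C → Prop
  | diag (p : OpenUnit) (U : C) : HasType (.diag p U) [U] [U, U]
  | bang (U : C) : HasType (.bang U) [U] []
  | tape {U V : C} (c : U ⟶ V) : HasType (.tape c) [U] [V]
  | cobang (U : C) : HasType (.cobang U) [] [U]
  | codiag (U : C) : HasType (.codiag U) [U, U] [U]
  | idLetter (U : C) : HasType (.idLetter U) [U] [U]
  | idZero : HasType .idZero [] []
  | swap (U V : C) : HasType (.swap U V) [U, V] [V, U]
  | comp {t s : Term C} {P Q R : List C} :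
      HasType t P Q → HasType s Q R → HasType (.comp t s) P R
  | sum {t s : Term C} {P₁ Q₁ P₂ Q₂ : List C} :
      HasType t P₁ Q₁ → HasType s P₂ Q₂ → HasType (.sum t s) (P₁ ++ P₂) (Q₁ ++ Q₂)

namespace Term

/-- `id_P`. -/
def idW : List C → Term C
  | [] => idZero
  | U :: P => sum (idLetter U) (idW P)

/-- `!_P`. -/
def bangW : List C → Term C
  | [] => idZero
  | U :: P => sum (bang U) (bangW P)

/-- The cobang at a word `P`. -/
def cobangW : List C → Term C
  | [] => idZero
  | U :: P => sum (cobang U) (cobangW P)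

/-- `σ_{U,Q} : U ⊕ Q → Q ⊕ U` for an object `U` of `C` and a word `Q`. -/
def swapL (U : C) : List C → Term C
  | [] => idLetter U
  | V :: Q => comp (sum (swap U V) (idW Q)) (sum (idLetter V) (swapL U Q))

/-- `σ_{P,Q} : P ⊕ Q → Q ⊕ P`. -/
def swapW : List C → List C → Term C
  | [], Q => idW Q
  | U :: P, Q => comp (sum (idLetter U) (swapW P Q)) (sum (swapL U Q) (idW P))

/-- The `p`-diagonal at a word. -/
def diagW (p : OpenUnit) : List C → Term C
  | [] => idZero
  | U :: P =>
    comp (sum (diag p U) (diagW p P)) (sum (idLetter U) (sum (swapW [U] P) (idW P)))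

/-- The codiagonal at a word. -/
def codiagW : List C → Term C
  | [] => idZero
  | U :: P =>
    comp (sum (idLetter U) (sum (swapW P [U]) (idW P))) (sum (codiag U) (codiagW P))

end Term

theorem HasType.cast {t : Term C} {P Q P' Q' : List C} (h : HasType t P Q) (hP : P = P')
    (hQ : Q = Q') : HasType t P' Q' := hP ▸ hQ ▸ h

theorem hasType_idW : ∀ P : List C, HasType (Term.idW P) P P
  | [] => .idZero
  | U :: P => .sum (.idLetter U) (hasType_idW P)

theorem hasType_bangW : ∀ P : List C, HasType (Term.bangW P) P []
  | [] => .idZero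
  | U :: P => .sum (.bang U) (hasType_bangW P)

theorem hasType_cobangW : ∀ P : List C, HasType (Term.cobangW P) [] P
  | [] => .idZero
  | U :: P => .sum (.cobang U) (hasType_cobangW P)

theorem hasType_swapL (U : C) : ∀ Q : List C, HasType (Term.swapL U Q) (U :: Q) (Q ++ [U])
  | [] => .idLetter U
  | V :: Q =>
    .comp (Q := [V] ++ U :: Q) ((HasType.swap U V).sum (hasType_idW Q))
      ((HasType.idLetter V).sum (hasType_swapL U Q))

theorem hasType_swapW : ∀ P Q : List C, HasType (Term.swapW P Q) (P ++ Q) (Q ++ P)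
  | [], Q => (hasType_idW Q).cast rfl (by simp)
  | U :: P, Q =>
    .comp (Q := [U] ++ (Q ++ P)) ((HasType.idLetter U).sum (hasType_swapW P Q))
      (((hasType_swapL U Q).sum (hasType_idW P)).cast (by simp) (by simp))

theorem hasType_diagW (p : OpenUnit) : ∀ P : List C, HasType (Term.diagW p P) P (P ++ P)
  | [] => .idZero
  | U :: P =>
    .comp (.sum (.diag p U) (hasType_diagW p P))
      (((HasType.idLetter U).sum ((hasType_swapW [U] P).sum (hasType_idW P))).cast
        (by simp) (by simp))

theorem hasType_codiagW : ∀ P : List C, HasType (Term.codiagW P) (P ++ P) P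
  | [] => .idZero
  | U :: P =>
    .comp (((HasType.idLetter U).sum ((hasType_swapW P [U]).sum (hasType_idW P))).cast
      (by simp) (by simp)) (.sum (.codiag U) (hasType_codiagW P))

/-! ### The equational theory -/

open Term in
/-- `TapeEq P Q t s`: the terms `t, s : P → Q` are equal modulo the axioms of strict symmetric
monoidal categories, of natural and coherent monoids, of natural and coherent co-pcas, and the two
axioms that make `tape` functorial. -/
inductive TapeEq : List C → List C → Term C → Term C → Prop
  -- equivalence relation and congruence
  | refl {t : Term C} {P Q : List C} : HasType t P Q → TapeEq P Q t t
  | symm {t s : Term C} {P Q : List C} : TapeEq P Q t s → TapeEq P Q s t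
  | trans {t s r : Term C} {P Q : List C} : TapeEq P Q t s → TapeEq P Q s r → TapeEq P Q t r
  | comp_congr {t t' s s' : Term C} {P Q R : List C} :
      TapeEq P Q t t' → TapeEq Q R s s' → TapeEq P R (comp t s) (comp t' s')
  | sum_congr {t t' s s' : Term C} {P₁ Q₁ P₂ Q₂ : List C} :
      TapeEq P₁ Q₁ t t' → TapeEq P₂ Q₂ s s' →
      TapeEq (P₁ ++ P₂) (Q₁ ++ Q₂) (sum t s) (sum t' s')
  -- strict symmetric monoidal categories
  | comp_assoc {f g h : Term C} {P Q R S : List C} :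
      HasType f P Q → HasType g Q R → HasType h R S →
      TapeEq P S (comp (comp f g) h) (comp f (comp g h))
  | id_comp {f : Term C} {P Q : List C} : HasType f P Q → TapeEq P Q (comp (idW P) f) f
  | comp_id {f : Term C} {P Q : List C} : HasType f P Q → TapeEq P Q (comp f (idW Q)) f
  | interchange {f₁ f₂ g₁ g₂ : Term C} {P₁ Q₁ R₁ P₂ Q₂ R₂ : List C} :
      HasType f₁ P₁ Q₁ → HasType g₁ Q₁ R₁ → HasType f₂ P₂ Q₂ → HasType g₂ Q₂ R₂ →
      TapeEq (P₁ ++ P₂) (R₁ ++ R₂) (comp (sum f₁ f₂) (sum g₁ g₂))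
        (sum (comp f₁ g₁) (comp f₂ g₂))
  | zero_sum {f : Term C} {P Q : List C} : HasType f P Q → TapeEq P Q (sum idZero f) f
  | sum_zero {f : Term C} {P Q : List C} : HasType f P Q → TapeEq P Q (sum f idZero) f
  | sum_assoc {f g h : Term C} {P₁ Q₁ P₂ Q₂ P₃ Q₃ : List C} :
      HasType f P₁ Q₁ → HasType g P₂ Q₂ → HasType h P₃ Q₃ →
      TapeEq (P₁ ++ P₂ ++ P₃) (Q₁ ++ Q₂ ++ Q₃) (sum (sum f g) h) (sum f (sum g h))
  | swap_swap (P Q : List C) :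
      TapeEq (P ++ Q) (P ++ Q) (comp (swapW P Q) (swapW Q P)) (idW (P ++ Q))
  | swap_nat {s : Term C} {P Q : List C} (R : List C) : HasType s P Q →
      TapeEq (P ++ R) (R ++ Q) (comp (sum s (idW R)) (swapW Q R))
        (comp (swapW P R) (sum (idW R) s))
  -- natural and coherent monoids
  | codiag_assoc (P : List C) :
      TapeEq (P ++ P ++ P) P (comp (sum (idW P) (codiagW P)) (codiagW P))
        (comp (sum (codiagW P) (idW P)) (codiagW P))
  | codiag_unit (P : List C) :
      TapeEq P P (comp (sum (cobangW P) (idW P)) (codiagW P)) (idW P)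
  | cobang_zero : TapeEq [] [] (cobangW []) (idW [])
  | codiag_zero : TapeEq [] [] (codiagW []) (idW [])
  | codiag_swap (P : List C) :
      TapeEq (P ++ P) P (comp (swapW P P) (codiagW P)) (codiagW P)
  | cobang_coh (P Q : List C) :
      TapeEq [] (P ++ Q) (cobangW (P ++ Q)) (sum (cobangW P) (cobangW Q))
  | codiag_coh (P Q : List C) :
      TapeEq (P ++ Q ++ (P ++ Q)) (P ++ Q) (codiagW (P ++ Q))
        (comp (sum (idW P) (sum (swapW Q P) (idW Q))) (sum (codiagW P) (codiagW Q)))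
  | cobang_nat {f : Term C} {P Q : List C} : HasType f P Q →
      TapeEq [] Q (comp (cobangW P) f) (cobangW Q)
  | codiag_nat {f : Term C} {P Q : List C} : HasType f P Q →
      TapeEq (P ++ P) Q (comp (codiagW P) f) (comp (sum f f) (codiagW Q))
  -- natural and coherent co-pcas
  | diag_assoc (p q : OpenUnit) (P : List C) :
      TapeEq P (P ++ P ++ P) (comp (diagW p P) (sum (diagW q P) (idW P)))
        (comp (diagW (OpenUnit.tildeP p q) P) (sum (idW P) (diagW (OpenUnit.tildeQ p q) P)))
  | diag_idem (p : OpenUnit) (P : List C) :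
      TapeEq P P (comp (diagW p P) (codiagW P)) (idW P)
  | diag_swap (p : OpenUnit) (P : List C) :
      TapeEq P (P ++ P) (comp (diagW p P) (swapW P P)) (diagW p.compl P)
  | diag_zero (p : OpenUnit) : TapeEq [] [] (diagW p []) (idW [])
  | bang_zero : TapeEq [] [] (bangW []) (idW [])
  | bang_coh (P Q : List C) :
      TapeEq (P ++ Q) [] (bangW (P ++ Q)) (sum (bangW P) (bangW Q))
  | diag_coh (p : OpenUnit) (P Q : List C) :
      TapeEq (P ++ Q) (P ++ Q ++ (P ++ Q)) (diagW p (P ++ Q))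
        (comp (sum (diagW p P) (diagW p Q)) (sum (idW P) (sum (swapW P Q) (idW Q))))
  | bang_nat {f : Term C} {P Q : List C} : HasType f P Q →
      TapeEq P [] (comp f (bangW Q)) (bangW P)
  | diag_nat {f : Term C} {P Q : List C} (p : OpenUnit) : HasType f P Q →
      TapeEq P (Q ++ Q) (comp f (diagW p Q)) (comp (diagW p P) (sum f f))
  -- functoriality of tapes
  | tape_id (U : C) : TapeEq [U] [U] (tape (𝟙 U)) (idW [U])
  | tape_comp {U V W : C} (c : U ⟶ V) (d : V ⟶ W) :
      TapeEq [U] [W] (tape (c ≫ d)) (comp (tape c) (tape d))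

/-! ### The category `T(C)` -/

/-- Typed terms modulo provable equality. -/
def tapeSetoid (P Q : List C) : Setoid {t : Term C // HasType t P Q} where
  r a b := TapeEq P Q a.1 b.1
  iseqv := ⟨fun a => .refl a.2, fun h => .symm h, fun h k => .trans h k⟩

/-- Arrows `P → Q` of `T(C)`. -/
def TapeHom (P Q : List C) : Type (max u v) := Quotient (tapeSetoid P Q)

/-- The arrow of `T(C)` given by a typed term. -/
def TapeHom.mk {P Q : List C} (t : Term C) (h : HasType t P Q) : TapeHom P Q :=
  Quotient.mk (tapeSetoid P Q) ⟨t, h⟩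

/-- The objects of `T(C)`: words over the objects of `C`. -/
def Tape (C : Type u) : Type u := List C

/-- The category `T(C)`. -/
instance : Category.{max u v} (Tape C) where
  Hom P Q := TapeHom (C := C) P Q
  id P := TapeHom.mk (Term.idW P) (hasType_idW P)
  comp f g := Quotient.map₂ (fun a b => ⟨Term.comp a.1 b.1, .comp a.2 b.2⟩)
    (fun _ _ h _ _ k => TapeEq.comp_congr h k) f g
  id_comp f := by
    induction f using Quotient.inductionOn with
    | h a => exact Quotient.sound (TapeEq.id_comp a.2)
  comp_id f := by
    induction f using Quotient.inductionOn with
    | h a => exact Quotient.sound (TapeEq.comp_id a.2)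
  assoc f g h := by
    induction f using Quotient.inductionOn with
    | h a =>
      induction g using Quotient.inductionOn with
      | h b =>
        induction h using Quotient.inductionOn with
        | h c => exact Quotient.sound (TapeEq.comp_assoc a.2 b.2 c.2)

namespace Tape

/-- The empty word `0`. -/
def zero : Tape C := ([] : List C)

/-- Concatenation of words `P ⊕ Q`. -/
def oplus (P Q : Tape C) : Tape C := List.append P Q

/-- The monoidal product `f ⊕ g` of arrows. -/
def sumHom {P₁ Q₁ P₂ Q₂ : Tape C} (f : P₁ ⟶ Q₁) (g : P₂ ⟶ Q₂) : oplus P₁ P₂ ⟶ oplus Q₁ Q₂ :=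
  Quotient.map₂ (fun a b => ⟨Term.sum a.1 b.1, .sum a.2 b.2⟩)
    (fun _ _ h _ _ k => TapeEq.sum_congr h k) f g

/-- The discharger `!_P`. -/
def bang (P : Tape C) : P ⟶ zero := TapeHom.mk (Term.bangW P) (hasType_bangW P)

/-- The unit of the monoid on `P`. -/
def cobang (P : Tape C) : zero ⟶ P := TapeHom.mk (Term.cobangW P) (hasType_cobangW P)

/-- The codiagonal. -/
def codiag (P : Tape C) : oplus P P ⟶ P := TapeHom.mk (Term.codiagW P) (hasType_codiagW P)

/-- The `p`-diagonal for `p ∈ (0,1)`. -/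
def diag (p : OpenUnit) (P : Tape C) : P ⟶ oplus P P :=
  TapeHom.mk (Term.diagW p P) (hasType_diagW p P)

/-- `f +_p g = diag_p ; (f ⊕ g) ; codiag` and `⋆ = bang ; cobang`. -/
def homOps (C : Type u) [Category.{v} C] : HomOps (Tape C) := fun P Q =>
  { star := bang P ≫ cobang Q
    conv := fun p f g => diag p P ≫ sumHom f g ≫ codiag Q }

/-- The projection `id ⊕ !`. -/
def π₁ (P₁ P₂ : Tape C) : oplus P₁ P₂ ⟶ P₁ :=
  TapeHom.mk (Term.sum (Term.idW P₁) (Term.bangW P₂))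
    (((hasType_idW P₁).sum (hasType_bangW P₂)).cast rfl (List.append_nil _))

/-- The projection `! ⊕ id`. -/
def π₂ (P₁ P₂ : Tape C) : oplus P₁ P₂ ⟶ P₂ :=
  TapeHom.mk (Term.sum (Term.bangW P₁) (Term.idW P₂)) ((hasType_bangW P₁).sum (hasType_idW P₂))

/-- The injection `id ⊕ cobang`. -/
def ι₁ (P₁ P₂ : Tape C) : P₁ ⟶ oplus P₁ P₂ :=
  TapeHom.mk (Term.sum (Term.idW P₁) (Term.cobangW P₂))
    (((hasType_idW P₁).sum (hasType_cobangW P₂)).cast (List.append_nil _) rfl)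

/-- The injection `cobang ⊕ id`. -/
def ι₂ (P₁ P₂ : Tape C) : P₂ ⟶ oplus P₁ P₂ :=
  TapeHom.mk (Term.sum (Term.cobangW P₁) (Term.idW P₂))
    ((hasType_cobangW P₁).sum (hasType_idW P₂))

/-- The structure on `T(C)` that is claimed to make it a convex biproduct category. -/
def convexBiproductData (C : Type u) [Category.{v} C] : ConvexBiproductData (Tape C) where
  homOps := homOps C
  zero := zero
  oplus := oplus
  π₁ := π₁
  π₂ := π₂
  ι₁ := ι₁
  ι₂ := ι₂

/-! ### The `n`-ary operations -/

/-- `⨁_{i=1}^n Q_i`. -/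
def bigOplus : ∀ {n : ℕ}, (Fin n → Tape C) → Tape C
  | 0, _ => zero
  | _ + 1, Q => oplus (Q 0) (bigOplus fun i => Q i.succ)

/-- `⨁_{i=1}^n t_i`. -/
def bigSumHom : ∀ {n : ℕ} {P Q : Fin n → Tape C}, (∀ i, P i ⟶ Q i) → (bigOplus P ⟶ bigOplus Q)
  | 0, _, _, _ => 𝟙 zero
  | _ + 1, _, _, t => sumHom (t 0) (bigSumHom fun i => t i.succ)

/-- The `i`-th projection `! ⊕ id ⊕ !` out of `⨁_{i=1}^n Q_i`. -/
def proj : ∀ {n : ℕ} (Q : Fin n → Tape C) (i : Fin n), bigOplus Q ⟶ Q i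
  | 0, _, i => i.elim0
  | _ + 1, Q, i =>
    Fin.cases (motive := fun i => bigOplus Q ⟶ Q i)
      (π₁ (Q 0) (bigOplus fun j => Q j.succ))
      (fun j => π₂ (Q 0) (bigOplus fun j => Q j.succ) ≫ proj (fun j => Q j.succ) j) i

open Classical in
/-- The `p`-diagonal for `p ∈ [0,1]`: it is `cobang ⊕ id` for `p = 0` and `id ⊕ cobang` for `p = 1`.
(It is only used for `p ∈ [0,1]`.) -/
def diagI (p : ℝ) (P : Tape C) : P ⟶ oplus P P :=
  if h : p ∈ Set.Ioo (0 : ℝ) 1 then diag ⟨p, h⟩ P else if p = 0 then ι₂ P P else ι₁ P P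

open Classical in
/-- The weights of the tail in the `n`-ary `p`-diagonal: `q_i = p_{i+1} / (1 - p_1)`, or `0` if
`p_1 = 1`. -/
def tailWeights {n : ℕ} (p : Fin (n + 1) → ℝ) : Fin n → ℝ := fun i =>
  if p 0 = 1 then 0 else p i.succ / (1 - p 0)

/-- The `n`-ary `p`-diagonal `P → ⨁_{i=1}^n P`. -/
def diagN : ∀ {n : ℕ} (_ : Fin n → ℝ) (P : Tape C), P ⟶ bigOplus fun _ : Fin n => P
  | 0, _, P => bang P
  | _ + 1, p, P => diagI (p 0) P ≫ sumHom (𝟙 P) (diagN (tailWeights p) P)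

end Tape

end ProbTape

end

/-!
The axioms of `T(C)` give most of the structure directly: naturality of the (co)monoid
operations makes the homsets pointed convex algebras with bilinear composition, and the natural
coherent monoids make `⊕` a coproduct (`oplus_hom_ext`). The arrow `Δ^p ; ⨁ tᵢ` has the required
components by a short induction (`diagN_bigSumHom_proj`). The substance is the uniqueness of
convex pairings, that is, the joint monicity of the projections (`hom_ext_π`).

Since `½ · id = π₁ ; ι₁ +_{1/2} π₂ ; ι₂`, the components of `h` determine `½ · h`, so it is
enough to cancel the scalar `½` in the homsets (`half_cancel`). Pointed convex algebras need not
be cancellative (in a semilattice every `+_p` is the join), so this uses that the homsets of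
`T(C)` are free. By the coproduct property the domain may be taken to be a single letter `U`.
Then three facts are combined.

* Every arrow `U ⟶ Q` is a convex combination of `⋆` and the arrows `c ; ι` with `c : U ⟶ V` in
  `C` and `ι` the injection of a letter `V` of `Q` (`hull_generator`, by induction on terms).
* Terms have a sound interpretation as transformers of test functions (`Term.sem`,
  `TapeEq.sem_agree`): a term `U ⟶ Q` denotes a finite subdistribution on pairs of a position in
  `Q` and an arrow of `C`, and the transformer takes expected values. This yields affine
  functions on the homset that are dual to the generators above (`coord_generator`).
* In a convex algebra, points of the hull of a family with a dual family of affine functions are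
  separated by these functions (`PCAOps.Hull.eq_of_dual`). The convex algebra embeds into its
  cone of formal positive multiples, which is a commutative monoid; there every point of the
  hull is a finite linear combination of the generators, whose coefficients are read off by the
  dual functions.
-/

noncomputable section

namespace ProbTape

/-! ### Convex combinations in pointed convex algebras -/

namespace OpenUnit

theorem ext_val {p q : OpenUnit} (h : p.1 = q.1) : p = q := Subtype.ext h

end OpenUnit

namespace PCAOps

variable {X : Type w} {A : PCAOps X}

theorem convI_of_mem {p : ℝ} (h : p ∈ Set.Ioo (0 : ℝ) 1) (x y : X) :
    A.convI p x y = A.conv ⟨p, h⟩ x y := dif_pos h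

theorem convI_zero (x y : X) : A.convI 0 x y = y := by simp [convI]

theorem convI_one (x y : X) : A.convI 1 x y = x := by simp [convI]

theorem mem_Icc_cases {p : ℝ} (h : p ∈ Set.Icc (0 : ℝ) 1) :
    p = 0 ∨ p = 1 ∨ p ∈ Set.Ioo (0 : ℝ) 1 := by
  rcases h.1.eq_or_lt with h0 | h0
  · exact Or.inl h0.symm
  rcases h.2.eq_or_lt with h1 | h1
  · exact Or.inr (Or.inl h1)
  · exact Or.inr (Or.inr ⟨h0, h1⟩)

theorem IsPCA.convI_comm (hA : A.IsPCA) {p : ℝ} (hp : p ∈ Set.Icc (0 : ℝ) 1) (x y : X) :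
    A.convI p x y = A.convI (1 - p) y x := by
  rcases mem_Icc_cases hp with rfl | rfl | h
  · simp [convI_zero, convI_one]
  · simp [convI_zero, convI_one]
  · have h' : 1 - p ∈ Set.Ioo (0 : ℝ) 1 := (OpenUnit.compl ⟨p, h⟩).2
    rw [convI_of_mem h, convI_of_mem h', hA.comm]
    rfl

theorem IsPCA.scale_scale (hA : A.IsPCA) {p q : ℝ} (hp : p ∈ Set.Icc (0 : ℝ) 1)
    (hq : q ∈ Set.Icc (0 : ℝ) 1) (x : X) : A.scale p (A.scale q x) = A.scale (p * q) x := by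
  unfold scale
  rcases mem_Icc_cases hp with rfl | rfl | h
  · simp [convI_zero]
  · simp [convI_one]
  rcases mem_Icc_cases hq with rfl | rfl | k
  · rw [mul_zero, convI_zero, convI_of_mem h, hA.idem]
  · rw [mul_one, convI_one]
  · have hpq : p * q ∈ Set.Ioo (0 : ℝ) 1 := OpenUnit.mul_mem ⟨p, h⟩ ⟨q, k⟩
    rw [convI_of_mem h, convI_of_mem k, convI_of_mem hpq, hA.assoc, hA.idem]
    rfl

theorem IsPCA.convI_star_left (hA : A.IsPCA) {p : ℝ} (hp : p ∈ Set.Icc (0 : ℝ) 1) (x : X) :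
    A.convI p A.star x = A.scale (1 - p) x := hA.convI_comm hp _ _

/-! ### The cone of a pointed convex algebra -/

/-- The strictly positive part `ℝ_{>0} × X` of the cone over the convex algebra `X`: the pair
`(r, x)` stands for the formal multiple `r x`. The proof that `A` is a convex algebra is a parameter
because the addition is associative and commutative by the laws of `A`. -/
@[ext]
structure PosCone (A : PCAOps X) (hA : A.IsPCA) where
  weight : ℝ
  pos : 0 < weight
  point : X

namespace PosCone

variable {hA : A.IsPCA}

theorem ratio_mem {r s : ℝ} (hr : 0 < r) (hs : 0 < s) : r / (r + s) ∈ Set.Ioo (0 : ℝ) 1 :=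
  ⟨by positivity, by rw [div_lt_one (by positivity)]; linarith⟩

/-- `r x + s y = (r + s) (x +_{r/(r+s)} y)`. -/
instance : Add (PosCone A hA) where
  add a b := ⟨a.weight + b.weight, add_pos a.pos b.pos,
    A.conv ⟨_, ratio_mem a.pos b.pos⟩ a.point b.point⟩

theorem add_def (a b : PosCone A hA) : a + b = ⟨a.weight + b.weight, add_pos a.pos b.pos,
    A.conv ⟨_, ratio_mem a.pos b.pos⟩ a.point b.point⟩ := rfl

instance : AddCommSemigroup (PosCone A hA) where
  add_assoc a b c := by
    have ha := a.pos
    have hb := b.pos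
    have hc := c.pos
    ext
    · exact add_assoc _ _ _
    · simp only [add_def, hA.assoc]
      congr 1
      · apply OpenUnit.ext_val
        simp only [OpenUnit.tildeP]
        field_simp
        ring
      · congr 1
        apply OpenUnit.ext_val
        simp only [OpenUnit.tildeQ]
        have h1 : 1 - (a.weight + b.weight) / (a.weight + b.weight + c.weight) *
          (a.weight / (a.weight + b.weight)) =
            (b.weight + c.weight) / (a.weight + b.weight + c.weight) := by
          field_simp
          ring
        rw [h1]
        field_simp
        ring
  add_comm a b := by
    have ha := a.pos
    have hb := b.pos
    ext
    · exact add_comm _ _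
    · simp only [add_def]
      rw [hA.comm]
      congr 1
      apply OpenUnit.ext_val
      simp only [OpenUnit.compl]
      field_simp
      ring

end PosCone

/-- The cone over a convex algebra, a commutative monoid. -/
abbrev Cone (A : PCAOps X) (hA : A.IsPCA) : Type w := WithZero (PosCone A hA)

namespace Cone

variable (hA : A.IsPCA)

open scoped NNReal
open Classical in
/-- The map `r ↦ r x`, for `r ≥ 0`. It is additive because `x +_p x = x`. -/
def ray (x : X) : ℝ≥0 →+ Cone A hA where
  toFun r := if h : 0 < (r : ℝ) then ((⟨r, h, x⟩ : PosCone A hA) : Cone A hA) else 0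
  map_zero' := by simp
  map_add' r s := by
    rcases eq_or_ne r 0 with rfl | hr
    · simp
    rcases eq_or_ne s 0 with rfl | hs
    · simp
    have hr' : 0 < (r : ℝ) := by positivity
    have hs' : 0 < (s : ℝ) := by positivity
    have hrs : 0 < ((r + s : ℝ≥0) : ℝ) := by positivity
    rw [dif_pos hr', dif_pos hs', dif_pos hrs, ← WithZero.coe_add, PosCone.add_def]
    simp only [hA.idem]
    rfl

theorem ray_of_pos (x : X) {r : ℝ≥0} (h : 0 < (r : ℝ)) :
    ray hA x r = ((⟨r, h, x⟩ : PosCone A hA) : Cone A hA) := dif_pos h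

theorem ray_one_injective : Function.Injective fun x : X => ray hA x 1 := by
  intro x y h
  simp only [ray_of_pos hA _ (r := 1) (by simp), WithZero.coe_inj] at h
  exact congrArg PosCone.point h

/-- The scalar `p`, as a nonnegative real. -/
def toNN (p : OpenUnit) : ℝ≥0 := ⟨p.1, p.2.1.le⟩

/-- `r (x +_p y) = (r p) x + (r (1 - p)) y`. -/
theorem ray_conv (p : OpenUnit) (x y : X) (r : ℝ≥0) :
    ray hA (A.conv p x y) r = ray hA x (r * toNN p) + ray hA y (r * toNN p.compl) := by
  rcases eq_or_ne r 0 with rfl | hr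
  · simp
  have hr' : 0 < (r : ℝ) := by positivity
  have h1 : 0 < ((r * toNN p : ℝ≥0) : ℝ) := mul_pos hr' p.2.1
  have h2 : 0 < ((r * toNN p.compl : ℝ≥0) : ℝ) := mul_pos hr' p.compl.2.1
  rw [ray_of_pos hA _ hr', ray_of_pos hA _ h1, ray_of_pos hA _ h2, ← WithZero.coe_add,
    PosCone.add_def, WithZero.coe_inj]
  have h3 : ((r * toNN p : ℝ≥0) : ℝ) + ((r * toNN p.compl : ℝ≥0) : ℝ) = r := by
    change (r : ℝ) * p.1 + r * (1 - p.1) = r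
    ring
  ext
  · exact h3.symm
  · simp only
    congr 1
    apply OpenUnit.ext_val
    simp only [h3]
    change p.1 = (r : ℝ) * p.1 / r
    field_simp

end Cone

/-- A real function on a convex algebra that preserves binary convex combinations. -/
def IsAffine (A : PCAOps X) (F : X → ℝ) : Prop :=
  ∀ (p : OpenUnit) (x y : X), F (A.conv p x y) = p.1 * F x + (1 - p.1) * F y

namespace Cone

variable (hA : A.IsPCA)

open scoped NNReal

/-- The additive extension `r x ↦ r F(x)` of an affine function to the cone. -/
def lift {F : X → ℝ} (hF : A.IsAffine F) : Cone A hA →+ ℝ :=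
  WithZero.lift
    { toFun := fun a => a.weight * F a.point
      map_add' := fun a b => by
        have ha := a.pos
        have hb := b.pos
        simp only [PosCone.add_def, hF _ _ _]
        field_simp
        ring }

theorem lift_ray {F : X → ℝ} (hF : A.IsAffine F) (x : X) (r : ℝ≥0) :
    lift hA hF (ray hA x r) = r * F x := by
  rcases eq_or_ne r 0 with rfl | hr
  · simp
  have hr' : 0 < (r : ℝ) := by positivity
  rw [ray_of_pos hA _ hr']
  rfl

end Cone

/-- The set of convex combinations of a family `e`. -/
inductive Hull (A : PCAOps X) {I : Type*} (e : I → X) : X → Prop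
  | gen (i : I) : Hull A e (e i)
  | conv (p : OpenUnit) {x y : X} : Hull A e x → Hull A e y → Hull A e (A.conv p x y)

open scoped NNReal in
/-- In the cone, the multiples of a point of the hull are linear combinations of the generators. -/
theorem Hull.exists_finsupp (hA : A.IsPCA) {I : Type*} {e : I → X} {x : X} (h : A.Hull e x)
    (r : ℝ≥0) : ∃ a : I →₀ ℝ≥0,
      Finsupp.liftAddHom (fun i => Cone.ray hA (e i)) a = Cone.ray hA x r := by
  induction h generalizing r with
  | gen i => exact ⟨Finsupp.single i r, Finsupp.liftAddHom_apply_single _ _ _⟩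
  | conv p _ _ ihx ihy =>
    obtain ⟨a, ha⟩ := ihx (r * Cone.toNN p)
    obtain ⟨b, hb⟩ := ihy (r * Cone.toNN p.compl)
    exact ⟨a + b, by rw [map_add, ha, hb, Cone.ray_conv]⟩

/-- Barycentric coordinates: if affine functions `F i` are dual to the generators `e i`, then they
separate the points of the hull, because the coefficients of a point in the cone are its values
under the `F i`. -/
theorem Hull.eq_of_dual (hA : A.IsPCA) {I : Type*} [DecidableEq I] {e : I → X} {F : I → X → ℝ}
    (hF : ∀ i, A.IsAffine (F i)) (hdual : ∀ i j, F i (e j) = if j = i then 1 else 0)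
    {x y : X} (hx : A.Hull e x) (hy : A.Hull e y) (hxy : ∀ i, F i x = F i y) : x = y := by
  obtain ⟨a, ha⟩ := hx.exists_finsupp hA 1
  obtain ⟨b, hb⟩ := hy.exists_finsupp hA 1
  have key : ∀ (i : I) (c : I →₀ NNReal),
      Cone.lift hA (hF i) (Finsupp.liftAddHom (fun i => Cone.ray hA (e i)) c) = c i := by
    intro i c
    induction c using Finsupp.induction_linear with
    | zero => simp
    | add f g hf hg => rw [map_add, map_add, hf, hg]; simp
    | single j r =>
      rw [Finsupp.liftAddHom_apply_single, Cone.lift_ray, hdual, Finsupp.single_apply]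
      split_ifs <;> simp
  have hab : a = b := by
    ext i
    rw [← key i a, ← key i b, ha, hb, Cone.lift_ray, Cone.lift_ray, hxy]
  apply Cone.ray_one_injective hA
  simp only [← ha, ← hb, hab]

end PCAOps

variable {C : Type u} [Category.{v} C]

/-! ### Typing of provably equal terms -/

theorem TapeEq.hasType {t s : Term C} {P Q : List C} (h : TapeEq P Q t s) :
    HasType t P Q ∧ HasType s P Q := by
  induction h with
  | refl h => exact ⟨h, h⟩
  | symm _ ih => exact ih.symm
  | trans _ _ ih₁ ih₂ => exact ⟨ih₁.1, ih₂.2⟩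
  | comp_congr _ _ ih₁ ih₂ => exact ⟨ih₁.1.comp ih₂.1, ih₁.2.comp ih₂.2⟩
  | sum_congr _ _ ih₁ ih₂ => exact ⟨ih₁.1.sum ih₂.1, ih₁.2.sum ih₂.2⟩
  | comp_assoc h₁ h₂ h₃ => exact ⟨(h₁.comp h₂).comp h₃, h₁.comp (h₂.comp h₃)⟩
  | id_comp h => exact ⟨(hasType_idW _).comp h, h⟩
  | comp_id h => exact ⟨h.comp (hasType_idW _), h⟩
  | interchange h₁ h₂ h₃ h₄ => exact ⟨(h₁.sum h₃).comp (h₂.sum h₄), (h₁.comp h₂).sum (h₃.comp h₄)⟩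
  | zero_sum h => exact ⟨HasType.idZero.sum h, h⟩
  | sum_zero h => exact ⟨(h.sum HasType.idZero).cast (by simp) (by simp), h⟩
  | sum_assoc h₁ h₂ h₃ =>
    exact ⟨(h₁.sum h₂).sum h₃, (h₁.sum (h₂.sum h₃)).cast (by simp) (by simp)⟩
  | swap_swap P Q => exact ⟨(hasType_swapW P Q).comp (hasType_swapW Q P), hasType_idW _⟩
  | swap_nat R h =>
    exact ⟨(h.sum (hasType_idW R)).comp (hasType_swapW _ R),
      (hasType_swapW _ R).comp ((hasType_idW R).sum h)⟩
  | codiag_assoc P =>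
    exact ⟨(((hasType_idW P).sum (hasType_codiagW P)).cast (by simp) rfl).comp (hasType_codiagW P),
      ((hasType_codiagW P).sum (hasType_idW P)).comp (hasType_codiagW P)⟩
  | codiag_unit P =>
    exact ⟨((hasType_cobangW P).sum (hasType_idW P)).comp (hasType_codiagW P), hasType_idW P⟩
  | cobang_zero => exact ⟨.idZero, .idZero⟩
  | codiag_zero => exact ⟨.idZero, .idZero⟩
  | codiag_swap P => exact ⟨(hasType_swapW P P).comp (hasType_codiagW P), hasType_codiagW P⟩
  | cobang_coh P Q => exact ⟨hasType_cobangW _, (hasType_cobangW P).sum (hasType_cobangW Q)⟩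
  | codiag_coh P Q =>
    exact ⟨hasType_codiagW _, (((hasType_idW P).sum ((hasType_swapW Q P).sum (hasType_idW Q))).cast
      (by simp) (by simp)).comp ((hasType_codiagW P).sum (hasType_codiagW Q))⟩
  | cobang_nat h => exact ⟨(hasType_cobangW _).comp h, hasType_cobangW _⟩
  | codiag_nat h => exact ⟨(hasType_codiagW _).comp h, (h.sum h).comp (hasType_codiagW _)⟩
  | diag_assoc p q P =>
    exact ⟨(hasType_diagW p P).comp ((hasType_diagW q P).sum (hasType_idW P)),
      (hasType_diagW _ P).comp (((hasType_idW P).sum (hasType_diagW _ P)).cast rfl (by simp))⟩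
  | diag_idem p P => exact ⟨(hasType_diagW p P).comp (hasType_codiagW P), hasType_idW P⟩
  | diag_swap p P => exact ⟨(hasType_diagW p P).comp (hasType_swapW P P), hasType_diagW _ P⟩
  | diag_zero p => exact ⟨.idZero, .idZero⟩
  | bang_zero => exact ⟨.idZero, .idZero⟩
  | bang_coh P Q => exact ⟨hasType_bangW _, (hasType_bangW P).sum (hasType_bangW Q)⟩
  | diag_coh p P Q =>
    exact ⟨hasType_diagW p _, ((hasType_diagW p P).sum (hasType_diagW p Q)).comp
      (((hasType_idW P).sum ((hasType_swapW P Q).sum (hasType_idW Q))).cast (by simp) (by simp))⟩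
  | bang_nat h => exact ⟨h.comp (hasType_bangW _), hasType_bangW _⟩
  | diag_nat p h => exact ⟨h.comp (hasType_diagW p _), (hasType_diagW p _).comp (h.sum h)⟩
  | tape_id U => exact ⟨.tape _, hasType_idW _⟩
  | tape_comp c d => exact ⟨.tape _, (HasType.tape c).comp (.tape d)⟩

theorem TapeEq.cast {t s : Term C} {P Q P' Q' : List C} (h : TapeEq P Q t s) (hP : P = P')
    (hQ : Q = Q') : TapeEq P' Q' t s := hP ▸ hQ ▸ h

/-! ### Equations between words -/

namespace TapeEq

open Term

theorem idW_append (P Q : List C) :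
    TapeEq (P ++ Q) (P ++ Q) (sum (idW P) (idW Q)) (idW (P ++ Q)) := by
  induction P with
  | nil => exact zero_sum (hasType_idW Q)
  | cons U P ih =>
    exact (sum_assoc (.idLetter U) (hasType_idW P) (hasType_idW Q)).trans
      (sum_congr (P₁ := [U]) (Q₁ := [U]) (.refl (.idLetter U)) ih)

theorem idW_singleton (U : C) : TapeEq [U] [U] (idW [U]) (idLetter U) :=
  sum_zero (.idLetter U)

theorem swapL_nil (U : C) : TapeEq [U] [U] (swapL U []) (idW [U]) :=
  (idW_singleton U).symm

theorem swapW_nil_right (P : List C) : TapeEq P P (swapW P []) (idW P) := by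
  induction P with
  | nil => exact .refl .idZero
  | cons U P ih =>
    have h : TapeEq ([U] ++ P) ([U] ++ P) (sum (idLetter U) (swapW P [])) (idW (U :: P)) :=
      sum_congr (P₁ := [U]) (Q₁ := [U]) (.refl (.idLetter U)) ih
    exact (comp_congr h (.refl ((HasType.idLetter U).sum (hasType_idW P)))).trans
      (comp_id (hasType_idW (U :: P)))

theorem diagW_singleton (p : OpenUnit) (U : C) :
    TapeEq [U] [U, U] (diagW p [U]) (Term.diag p U) := by
  have h : TapeEq ([U] ++ ([U] ++ [])) ([U] ++ ([U] ++ []))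
      (sum (idLetter U) (sum (swapW [U] []) (idW []))) (idW [U, U]) :=
    sum_congr (.refl (.idLetter U)) ((sum_zero (hasType_swapW [U] [])).trans (swapW_nil_right [U]))
  exact (comp_congr (sum_zero (.diag p U)) h).trans (comp_id (.diag p U))

theorem codiagW_singleton (U : C) : TapeEq [U, U] [U] (codiagW [U]) (Term.codiag U) := by
  have h : TapeEq ([U] ++ ([U] ++ [])) ([U] ++ ([U] ++ []))
      (sum (idLetter U) (sum (swapW [] [U]) (idW []))) (idW [U, U]) :=
    sum_congr (.refl (.idLetter U)) (sum_zero (hasType_idW [U]))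
  exact (comp_congr h (sum_zero (.codiag U))).trans (id_comp (.codiag U))

theorem swapW_singleton (U V : C) : TapeEq [U, V] [V, U] (swapW [U] [V]) (Term.swap U V) := by
  have h₁ : TapeEq ([U] ++ [V]) ([U] ++ [V]) (sum (idLetter U) (swapW [] [V])) (idW [U, V]) :=
    .refl (hasType_idW [U, V])
  have h₂ : TapeEq [U, V] [V, U] (swapL U [V]) (Term.swap U V) := by
    have h₄ : TapeEq ([V] ++ [U]) ([V] ++ [U]) (sum (idLetter V) (swapL U [])) (idW [V, U]) :=
      sum_congr (.refl (.idLetter V)) (swapL_nil U)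
    exact (comp_congr (sum_zero (.swap U V)) h₄).trans (comp_id (.swap U V))
  exact (comp_congr h₁ ((sum_zero (h₂.hasType.1)).trans h₂)).trans (id_comp (.swap U V))

/-- The empty word is initial. -/
theorem of_nil_left {t s : Term C} {Q : List C} (ht : HasType t [] Q) (hs : HasType s [] Q) :
    TapeEq [] Q t s :=
  ((id_comp ht).symm.trans (cobang_nat ht)).trans ((id_comp hs).symm.trans (cobang_nat hs)).symm

/-- The empty word is final. -/
theorem of_nil_right {t s : Term C} {P : List C} (ht : HasType t P []) (hs : HasType s P []) :
    TapeEq P [] t s :=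
  ((comp_id ht).symm.trans (bang_nat ht)).trans ((comp_id hs).symm.trans (bang_nat hs)).symm

/-- The two middle cobangs start at the empty word, so the coherence law of the codiagonal reduces
the codiagonal of a sum, precomposed with the injections, to codiagonals of the summands. -/
theorem sum_injections_codiagW (P Q : List C) : TapeEq (P ++ Q) (P ++ Q)
    (comp (sum (sum (idW P) (cobangW Q)) (sum (cobangW P) (idW Q))) (codiagW (P ++ Q)))
    (comp (sum (sum (idW P) (cobangW P)) (sum (cobangW Q) (idW Q)))
      (sum (codiagW P) (codiagW Q))) := by
  have tP := hasType_idW P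
  have tQ := hasType_idW Q
  have cP := hasType_cobangW P
  have cQ := hasType_cobangW Q
  -- Regrouping of a sum of four terms around its two middle ones.
  have regroup : ∀ R S : List C, TapeEq (P ++ Q) (P ++ (R ++ (S ++ Q)))
      (.sum (.sum (.idW P) (.cobangW R)) (.sum (.cobangW S) (.idW Q)))
      (.sum (.idW P) (.sum (.sum (.cobangW R) (.cobangW S)) (.idW Q))) := by
    intro R S
    have cR := hasType_cobangW R
    have cS := hasType_cobangW S
    have e₁ := (TapeEq.sum_assoc tP cR (cS.sum tQ)).cast (P' := P ++ Q)
      (Q' := P ++ (R ++ (S ++ Q))) (by simp) (by simp)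
    have e₂ := (TapeEq.sum_congr (.refl tP) (TapeEq.sum_assoc cR cS tQ)).cast (P' := P ++ Q)
      (Q' := P ++ (R ++ (S ++ Q))) (by simp) (by simp)
    exact e₁.trans e₂.symm
  have mid : TapeEq [] (P ++ Q) (.comp (.sum (.cobangW Q) (.cobangW P)) (.swapW Q P))
      (.sum (.cobangW P) (.cobangW Q)) :=
    .of_nil_left ((cQ.sum cP).comp (hasType_swapW Q P)) (cP.sum cQ)
  have inner := (TapeEq.interchange (cQ.sum cP) (hasType_swapW Q P) tQ tQ).trans
    (TapeEq.sum_congr mid (.comp_id tQ))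
  have outer := (TapeEq.interchange tP tP ((cQ.sum cP).sum tQ) ((hasType_swapW Q P).sum tQ)).trans
    (TapeEq.sum_congr (.comp_id tP) inner)
  have outer' := outer.cast (P' := P ++ Q) (Q' := P ++ (P ++ (Q ++ Q))) (by simp) (by simp)
  have e := ((TapeEq.comp_congr (regroup Q P) (.refl
    (((tP.sum ((hasType_swapW Q P).sum tQ))).cast (by simp) rfl))).cast rfl (by simp)).trans
      (outer'.trans (regroup P Q).symm)
  have hcast : P ++ (P ++ (Q ++ Q)) = P ++ P ++ (Q ++ Q) := by simp
  have tl : HasType (.sum (.sum (.idW P) (.cobangW Q)) (.sum (.cobangW P) (.idW Q))) (P ++ Q)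
      (P ++ Q ++ (P ++ Q)) := ((tP.sum cQ).sum (cP.sum tQ)).cast (by simp) rfl
  have tm : HasType (.sum (.idW P) (.sum (.swapW Q P) (.idW Q))) (P ++ Q ++ (P ++ Q))
      (P ++ P ++ (Q ++ Q)) := (tP.sum ((hasType_swapW Q P).sum tQ)).cast (by simp) (by simp)
  have tr := (hasType_codiagW P).sum (hasType_codiagW Q)
  exact ((TapeEq.comp_congr (.refl tl) (.codiag_coh P Q)).trans
    (TapeEq.comp_assoc tl tm tr).symm).trans
      (.comp_congr (e.cast rfl hcast) (.refl tr))

end TapeEq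

/-! ### The symmetric monoidal structure on arrows -/

theorem TapeHom.mk_eq {P Q : List C} {t s : Term C} {ht : HasType t P Q} {hs : HasType s P Q}
    (h : TapeEq P Q t s) : TapeHom.mk t ht = TapeHom.mk s hs := Quotient.sound h

theorem TapeHom.exists_mk {P Q : List C} (f : TapeHom P Q) : ∃ t h, f = TapeHom.mk t h := by
  induction f using Quotient.inductionOn with
  | h a => exact ⟨a.1, a.2, rfl⟩

namespace Tape

variable {P Q R S P₁ P₂ P₃ Q₁ Q₂ Q₃ R₁ R₂ : Tape C}

theorem sumHom_comp (f₁ : P₁ ⟶ Q₁) (f₂ : P₂ ⟶ Q₂) (g₁ : Q₁ ⟶ R₁) (g₂ : Q₂ ⟶ R₂) :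
    sumHom f₁ f₂ ≫ sumHom g₁ g₂ = sumHom (f₁ ≫ g₁) (f₂ ≫ g₂) := by
  obtain ⟨a, ha, rfl⟩ := TapeHom.exists_mk f₁
  obtain ⟨b, hb, rfl⟩ := TapeHom.exists_mk f₂
  obtain ⟨c, hc, rfl⟩ := TapeHom.exists_mk g₁
  obtain ⟨d, hd, rfl⟩ := TapeHom.exists_mk g₂
  exact TapeHom.mk_eq (.interchange ha hc hb hd)

theorem sumHom_id (P Q : Tape C) : sumHom (𝟙 P) (𝟙 Q) = 𝟙 (oplus P Q) :=
  TapeHom.mk_eq (TapeEq.idW_append P Q)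

theorem hom_ext_zero_left (f g : (zero : Tape C) ⟶ Q) : f = g := by
  obtain ⟨a, ha, rfl⟩ := TapeHom.exists_mk f
  obtain ⟨b, hb, rfl⟩ := TapeHom.exists_mk g
  exact TapeHom.mk_eq (.of_nil_left ha hb)

theorem hom_ext_zero_right (f g : P ⟶ (zero : Tape C)) : f = g := by
  obtain ⟨a, ha, rfl⟩ := TapeHom.exists_mk f
  obtain ⟨b, hb, rfl⟩ := TapeHom.exists_mk g
  exact TapeHom.mk_eq (.of_nil_right ha hb)

/-- The symmetry `σ_{P,Q}`. -/
def swap (P Q : Tape C) : oplus P Q ⟶ oplus Q P :=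
  TapeHom.mk (Term.swapW P Q) (hasType_swapW P Q)

theorem swap_swap (P Q : Tape C) : swap P Q ≫ swap Q P = 𝟙 _ :=
  TapeHom.mk_eq (.swap_swap P Q)

/-! ### Injections and projections -/

theorem ι₁_sumHom (f : P₁ ⟶ Q₁) (g : P₂ ⟶ Q₂) : ι₁ P₁ P₂ ≫ sumHom f g = f ≫ ι₁ Q₁ Q₂ := by
  obtain ⟨a, ha, rfl⟩ := TapeHom.exists_mk f
  obtain ⟨b, hb, rfl⟩ := TapeHom.exists_mk g
  apply TapeHom.mk_eq
  have h₁ := TapeEq.interchange (hasType_idW P₁) ha (hasType_cobangW P₂) hb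
  have h₂ := TapeEq.interchange ha (hasType_idW Q₁) .idZero (hasType_cobangW Q₂)
  have h₃ := TapeEq.comp_congr (TapeEq.sum_zero ha).symm
    (.refl (((hasType_idW Q₁).sum (hasType_cobangW Q₂)).cast (List.append_nil _) rfl))
  have h₄ := TapeEq.sum_congr (((TapeEq.id_comp ha)).trans (TapeEq.comp_id ha).symm)
    ((TapeEq.cobang_nat hb).trans (TapeEq.id_comp (hasType_cobangW Q₂)).symm)
  exact ((h₁.trans (h₄.trans h₂.symm)).cast (List.append_nil _) rfl).trans h₃.symm

theorem ι₂_sumHom (f : P₁ ⟶ Q₁) (g : P₂ ⟶ Q₂) : ι₂ P₁ P₂ ≫ sumHom f g = g ≫ ι₂ Q₁ Q₂ := by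
  obtain ⟨a, ha, rfl⟩ := TapeHom.exists_mk f
  obtain ⟨b, hb, rfl⟩ := TapeHom.exists_mk g
  apply TapeHom.mk_eq
  have h₁ := TapeEq.interchange (hasType_cobangW P₁) ha (hasType_idW P₂) hb
  have h₂ := TapeEq.interchange .idZero (hasType_cobangW Q₁) hb (hasType_idW Q₂)
  have h₃ := TapeEq.comp_congr (TapeEq.zero_sum hb).symm
    (.refl ((hasType_cobangW Q₁).sum (hasType_idW Q₂)))
  have h₄ := TapeEq.sum_congr
    ((TapeEq.cobang_nat ha).trans (TapeEq.id_comp (hasType_cobangW Q₁)).symm)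
    (((TapeEq.id_comp hb)).trans (TapeEq.comp_id hb).symm)
  exact (h₁.trans (h₄.trans h₂.symm)).trans h₃.symm

theorem sumHom_π₁ (f : P₁ ⟶ Q₁) (g : P₂ ⟶ Q₂) : sumHom f g ≫ π₁ Q₁ Q₂ = π₁ P₁ P₂ ≫ f := by
  obtain ⟨a, ha, rfl⟩ := TapeHom.exists_mk f
  obtain ⟨b, hb, rfl⟩ := TapeHom.exists_mk g
  apply TapeHom.mk_eq
  have h₁ := TapeEq.interchange ha (hasType_idW Q₁) hb (hasType_bangW Q₂)
  have h₂ := TapeEq.interchange (hasType_idW P₁) ha (hasType_bangW P₂) .idZero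
  have h₃ := TapeEq.comp_congr
    (.refl (((hasType_idW P₁).sum (hasType_bangW P₂)).cast rfl (List.append_nil _)))
    (TapeEq.sum_zero ha).symm
  have h₄ := TapeEq.sum_congr ((TapeEq.comp_id ha).trans (TapeEq.id_comp ha).symm)
    ((TapeEq.bang_nat hb).trans (TapeEq.comp_id (hasType_bangW P₂)).symm)
  exact ((h₁.trans (h₄.trans h₂.symm)).cast rfl (List.append_nil _)).trans h₃.symm

theorem sumHom_π₂ (f : P₁ ⟶ Q₁) (g : P₂ ⟶ Q₂) : sumHom f g ≫ π₂ Q₁ Q₂ = π₂ P₁ P₂ ≫ g := by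
  obtain ⟨a, ha, rfl⟩ := TapeHom.exists_mk f
  obtain ⟨b, hb, rfl⟩ := TapeHom.exists_mk g
  apply TapeHom.mk_eq
  have h₁ := TapeEq.interchange ha (hasType_bangW Q₁) hb (hasType_idW Q₂)
  have h₂ := TapeEq.interchange (hasType_bangW P₁) .idZero (hasType_idW P₂) hb
  have h₃ := TapeEq.comp_congr (.refl ((hasType_bangW P₁).sum (hasType_idW P₂)))
    (TapeEq.zero_sum hb).symm
  have h₄ := TapeEq.sum_congr
    ((TapeEq.bang_nat ha).trans (TapeEq.comp_id (hasType_bangW P₁)).symm)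
    ((TapeEq.comp_id hb).trans (TapeEq.id_comp hb).symm)
  exact (h₁.trans (h₄.trans h₂.symm)).trans h₃.symm

theorem ι₁_π₁ (P Q : Tape C) : ι₁ P Q ≫ π₁ P Q = 𝟙 P := by
  apply TapeHom.mk_eq
  have h := TapeEq.interchange (hasType_idW P) (hasType_idW P) (hasType_cobangW Q) (hasType_bangW Q)
  have h' := TapeEq.sum_congr (TapeEq.comp_id (hasType_idW P))
    (TapeEq.of_nil_left ((hasType_cobangW Q).comp (hasType_bangW Q)) .idZero)
  exact ((h.trans h').cast (List.append_nil _) (List.append_nil _)).trans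
    (.sum_zero (hasType_idW P))

theorem ι₂_π₂ (P Q : Tape C) : ι₂ P Q ≫ π₂ P Q = 𝟙 Q := by
  apply TapeHom.mk_eq
  have h := TapeEq.interchange (hasType_cobangW P) (hasType_bangW P) (hasType_idW Q) (hasType_idW Q)
  have h' := TapeEq.sum_congr
    (TapeEq.of_nil_left ((hasType_cobangW P).comp (hasType_bangW P)) .idZero)
    (TapeEq.comp_id (hasType_idW Q))
  exact (h.trans h').trans (.zero_sum (hasType_idW Q))

theorem ι₁_π₂ (P Q : Tape C) : ι₁ P Q ≫ π₂ P Q = bang P ≫ cobang Q := by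
  apply TapeHom.mk_eq
  have h := TapeEq.interchange (hasType_idW P) (hasType_bangW P) (hasType_cobangW Q) (hasType_idW Q)
  have h' := TapeEq.sum_congr
    ((TapeEq.id_comp (hasType_bangW P)).trans (TapeEq.comp_id (hasType_bangW P)).symm)
    ((TapeEq.comp_id (hasType_cobangW Q)).trans (TapeEq.id_comp (hasType_cobangW Q)).symm)
  have h'' := TapeEq.interchange (hasType_bangW P) .idZero .idZero (hasType_cobangW Q)
  refine (((h.trans h').trans h''.symm).cast (List.append_nil _) rfl).trans ?_
  exact .comp_congr (.sum_zero (hasType_bangW P)) (.zero_sum (hasType_cobangW Q))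

theorem ι₂_π₁ (P Q : Tape C) : ι₂ P Q ≫ π₁ P Q = bang Q ≫ cobang P := by
  apply TapeHom.mk_eq
  have h := TapeEq.interchange (hasType_cobangW P) (hasType_idW P) (hasType_idW Q) (hasType_bangW Q)
  have h' := TapeEq.sum_congr
    ((TapeEq.comp_id (hasType_cobangW P)).trans (TapeEq.id_comp (hasType_cobangW P)).symm)
    ((TapeEq.id_comp (hasType_bangW Q)).trans (TapeEq.comp_id (hasType_bangW Q)).symm)
  have h'' := TapeEq.interchange .idZero (hasType_cobangW P) (hasType_bangW Q) .idZero
  refine (((h.trans h').trans h''.symm).cast rfl (List.append_nil _)).trans ?_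
  exact .comp_congr (.zero_sum (hasType_bangW Q))
    ((TapeEq.sum_zero (hasType_cobangW P)))

theorem ι₂_swap (P Q : Tape C) : ι₂ P Q ≫ swap P Q = ι₁ Q P := by
  apply TapeHom.mk_eq
  exact (TapeEq.swap_nat Q (hasType_cobangW P)).trans
    (.id_comp (((hasType_idW Q).sum (hasType_cobangW P)).cast (List.append_nil _) rfl))

theorem ι₁_swap (P Q : Tape C) : ι₁ P Q ≫ swap P Q = ι₂ Q P := by
  rw [← ι₂_swap Q P, Category.assoc, swap_swap, Category.comp_id]

/-! ### Coproducts -/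

theorem ι₂_codiag (P : Tape C) : ι₂ P P ≫ codiag P = 𝟙 P :=
  TapeHom.mk_eq (.codiag_unit P)

theorem swap_codiag (P : Tape C) : swap P P ≫ codiag P = codiag P :=
  TapeHom.mk_eq (.codiag_swap P)

theorem ι₁_codiag (P : Tape C) : ι₁ P P ≫ codiag P = 𝟙 P := by
  rw [← swap_codiag, ← Category.assoc, ι₁_swap, ι₂_codiag]

theorem codiag_comp (f : P ⟶ Q) : codiag P ≫ f = sumHom f f ≫ codiag Q := by
  obtain ⟨a, ha, rfl⟩ := TapeHom.exists_mk f
  exact TapeHom.mk_eq (.codiag_nat ha)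

theorem sumHom_ι_codiag (P Q : Tape C) :
    sumHom (ι₁ P Q) (ι₂ P Q) ≫ codiag (oplus P Q) = 𝟙 _ := by
  have h : sumHom (ι₁ P P) (ι₂ Q Q) ≫ sumHom (codiag P) (codiag Q) = 𝟙 (oplus P Q) := by
    rw [sumHom_comp, ι₁_codiag, ι₂_codiag, sumHom_id]
  exact Eq.trans (TapeHom.mk_eq (TapeEq.sum_injections_codiagW P Q)) h

theorem oplus_hom_ext {f g : oplus P Q ⟶ R} (h₁ : ι₁ P Q ≫ f = ι₁ P Q ≫ g)
    (h₂ : ι₂ P Q ≫ f = ι₂ P Q ≫ g) : f = g := by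
  have key : ∀ k : oplus P Q ⟶ R, k = sumHom (ι₁ P Q ≫ k) (ι₂ P Q ≫ k) ≫ codiag R := by
    intro k
    rw [← sumHom_comp, Category.assoc, ← codiag_comp, ← Category.assoc, sumHom_ι_codiag,
      Category.id_comp]
  rw [key f, key g, h₁, h₂]

theorem ι₁_desc (f : P ⟶ R) (g : Q ⟶ R) : ι₁ P Q ≫ sumHom f g ≫ codiag R = f := by
  rw [← Category.assoc, ι₁_sumHom, Category.assoc, ι₁_codiag, Category.comp_id]

theorem ι₂_desc (f : P ⟶ R) (g : Q ⟶ R) : ι₂ P Q ≫ sumHom f g ≫ codiag R = g := by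
  rw [← Category.assoc, ι₂_sumHom, Category.assoc, ι₂_codiag, Category.comp_id]

theorem sumHom_swap (f : P₁ ⟶ Q₁) (g : P₂ ⟶ Q₂) :
    sumHom f g ≫ swap Q₁ Q₂ = swap P₁ P₂ ≫ sumHom g f := by
  apply oplus_hom_ext
  · rw [← Category.assoc, ι₁_sumHom, Category.assoc, ι₁_swap, ← Category.assoc, ι₁_swap, ι₂_sumHom]
  · rw [← Category.assoc, ι₂_sumHom, Category.assoc, ι₂_swap, ← Category.assoc, ι₂_swap, ι₁_sumHom]

/-! ### Enrichment over pointed convex algebras -/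

/-- Associativity of `⊕` on objects, an identity arrow up to the equality of words. -/
def assocHom (P Q R : Tape C) : oplus (oplus P Q) R ⟶ oplus P (oplus Q R) :=
  TapeHom.mk (Term.idW (oplus (oplus P Q) R)) ((hasType_idW _).cast rfl (List.append_assoc _ _ _))

theorem comp_assocHom {t : Term C} {P Q R : List C} {S : Tape C} (h : HasType t S (P ++ Q ++ R)) :
    (show S ⟶ oplus (oplus P Q) R from TapeHom.mk t h) ≫ assocHom P Q R =
      TapeHom.mk t (h.cast rfl (List.append_assoc _ _ _)) :=
  TapeHom.mk_eq ((TapeEq.comp_id h).cast rfl (List.append_assoc _ _ _))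

theorem assocHom_comp {t : Term C} {P Q R : List C} {S : Tape C} (h : HasType t (P ++ (Q ++ R)) S) :
    assocHom P Q R ≫ (show oplus P (oplus Q R) ⟶ S from TapeHom.mk t h) =
      TapeHom.mk t (h.cast (List.append_assoc _ _ _).symm rfl) :=
  TapeHom.mk_eq (TapeEq.id_comp (h.cast (List.append_assoc _ _ _).symm rfl))

theorem sumHom_assocHom (f : P₁ ⟶ Q₁) (g : P₂ ⟶ Q₂) (h : P₃ ⟶ Q₃) :
    sumHom (sumHom f g) h ≫ assocHom Q₁ Q₂ Q₃ = assocHom P₁ P₂ P₃ ≫ sumHom f (sumHom g h) := by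
  obtain ⟨a, ha, rfl⟩ := TapeHom.exists_mk f
  obtain ⟨b, hb, rfl⟩ := TapeHom.exists_mk g
  obtain ⟨c, hc, rfl⟩ := TapeHom.exists_mk h
  refine (comp_assocHom ((ha.sum hb).sum hc)).trans
    (Eq.trans ?_ (assocHom_comp (ha.sum (hb.sum hc))).symm)
  exact TapeHom.mk_eq ((TapeEq.sum_assoc ha hb hc).cast rfl (List.append_assoc _ _ _))

theorem diag_assoc (p q : OpenUnit) (P : Tape C) :
    diag p P ≫ sumHom (diag q P) (𝟙 P) ≫ assocHom P P P =
      diag (OpenUnit.tildeP p q) P ≫ sumHom (𝟙 P) (diag (OpenUnit.tildeQ p q) P) := by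
  rw [← Category.assoc]
  refine (comp_assocHom ((hasType_diagW p P).comp ((hasType_diagW q P).sum (hasType_idW P)))).trans
    (TapeHom.mk_eq ?_)
  exact (TapeEq.diag_assoc p q P).cast rfl (List.append_assoc _ _ _)

theorem codiag_assoc (P : Tape C) :
    assocHom P P P ≫ sumHom (𝟙 P) (codiag P) ≫ codiag P = sumHom (codiag P) (𝟙 P) ≫ codiag P :=
  (assocHom_comp (((hasType_idW P).sum (hasType_codiagW P)).comp (hasType_codiagW P))).trans
    (TapeHom.mk_eq (TapeEq.codiag_assoc P))

theorem diag_codiag (p : OpenUnit) (P : Tape C) : diag p P ≫ codiag P = 𝟙 P :=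
  TapeHom.mk_eq (.diag_idem p P)

theorem diag_swap (p : OpenUnit) (P : Tape C) : diag p P ≫ swap P P = diag p.compl P :=
  TapeHom.mk_eq (.diag_swap p P)

theorem comp_diag (p : OpenUnit) (f : P ⟶ Q) : f ≫ diag p Q = diag p P ≫ sumHom f f := by
  obtain ⟨a, ha, rfl⟩ := TapeHom.exists_mk f
  exact TapeHom.mk_eq (.diag_nat p ha)

theorem homOps_conv (p : OpenUnit) (f g : P ⟶ Q) :
    (homOps C P Q).conv p f g = diag p P ≫ sumHom f g ≫ codiag Q := rfl

theorem homOps_star (P Q : Tape C) : (homOps C P Q).star = bang P ≫ cobang Q := rfl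

theorem isPCA (P Q : Tape C) : (homOps C P Q).IsPCA where
  assoc p q x₁ x₂ x₃ := by
    have h₁ : sumHom (diag q P ≫ sumHom x₁ x₂ ≫ codiag Q) x₃ =
        sumHom (diag q P) (𝟙 P) ≫ sumHom (sumHom x₁ x₂) x₃ ≫ sumHom (codiag Q) (𝟙 Q) := by
      simp only [sumHom_comp, Category.id_comp, Category.comp_id]
    have h₂ : ∀ q', sumHom x₁ (diag q' P ≫ sumHom x₂ x₃ ≫ codiag Q) =
        sumHom (𝟙 P) (diag q' P) ≫ sumHom x₁ (sumHom x₂ x₃) ≫ sumHom (𝟙 Q) (codiag Q) := by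
      intro q'
      simp only [sumHom_comp, Category.id_comp, Category.comp_id]
    simp only [homOps_conv]
    rw [h₁, h₂]
    simp only [Category.assoc]
    rw [← codiag_assoc, ← Category.assoc (sumHom (sumHom x₁ x₂) x₃), sumHom_assocHom]
    simp only [Category.assoc]
    rw [← Category.assoc (diag (OpenUnit.tildeP p q) P), ← diag_assoc]
    simp only [Category.assoc]
  comm p x₁ x₂ := by
    simp only [homOps_conv]
    rw [← diag_swap, Category.assoc, ← Category.assoc (swap P P), ← sumHom_swap, Category.assoc,
      swap_codiag]
  idem p x := by
    rw [homOps_conv, ← codiag_comp, ← Category.assoc, diag_codiag, Category.id_comp]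

theorem isPCAEnriched : IsPCAEnriched (homOps C) where
  isPCA := isPCA
  comp_conv p _ _ _ e f g := by
    simp only [homOps_conv]
    rw [← Category.assoc, comp_diag, Category.assoc, ← Category.assoc (sumHom e e), sumHom_comp]
  conv_comp p _ _ _ f g h := by
    simp only [homOps_conv, Category.assoc]
    rw [codiag_comp, ← Category.assoc (sumHom f g), sumHom_comp]
  comp_star Z f := by
    rw [homOps_star, homOps_star, ← Category.assoc]
    congr 1
    exact hom_ext_zero_right _ _
  star_comp X _ _ f := by
    rw [homOps_star, homOps_star, Category.assoc]
    congr 1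
    exact hom_ext_zero_left _ _

/-- The `p`-diagonal is the convex combination of the two injections. -/
theorem diag_eq_conv (p : OpenUnit) (P : Tape C) :
    diag p P = (homOps C P (oplus P P)).conv p (ι₁ P P) (ι₂ P P) := by
  rw [homOps_conv, sumHom_ι_codiag, Category.comp_id]

theorem convI_eq (p : ℝ) (f g : P ⟶ Q) :
    (homOps C P Q).convI p f g = diagI p P ≫ sumHom f g ≫ codiag Q := by
  unfold PCAOps.convI diagI
  split_ifs
  · rfl
  · rw [ι₂_desc]
  · rw [ι₁_desc]

theorem diagI_sumHom_π₁ (p : ℝ) (f : P ⟶ Q) (g : P ⟶ R) :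
    (diagI p P ≫ sumHom f g) ≫ π₁ Q R = (homOps C P Q).scale p f := by
  rw [PCAOps.scale, convI_eq, Category.assoc, sumHom_π₁]
  congr 1
  apply oplus_hom_ext
  · rw [ι₁_desc, ← Category.assoc, ι₁_π₁, Category.id_comp]
  · rw [ι₂_desc, ← Category.assoc, ι₂_π₁]
    exact isPCAEnriched.star_comp _ _

theorem diagI_sumHom_π₂ (p : ℝ) (f : P ⟶ Q) (g : P ⟶ R) :
    (diagI p P ≫ sumHom f g) ≫ π₂ Q R = (homOps C P R).convI p (homOps C P R).star g := by
  rw [convI_eq, Category.assoc, sumHom_π₂]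
  congr 1
  apply oplus_hom_ext
  · rw [ι₁_desc, ← Category.assoc, ι₁_π₂]
    exact isPCAEnriched.star_comp _ _
  · rw [ι₂_desc, ← Category.assoc, ι₂_π₂, Category.id_comp]

end Tape

/-! ### Semantics of terms as transformers of test functions -/

/-- A test function, for a fixed object `A` of `C`: it assigns a real number to every position `n`
of a word and every arrow `A ⟶ V` into the letter `V` at that position. Positions are plain natural
numbers and `V` ranges over all objects, so that words that are equal only propositionally need no
transport; only the values at the actual letters of a word matter, see `TestFun.Agree`. -/
abbrev TestFun (A : C) : Type (max u v) := ℕ → ∀ V : C, (A ⟶ V) → ℝ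

namespace TestFun

variable {A : C}

/-- Equality of test functions on the positions and letters of the word `P`. -/
def Agree (P : List C) (φ ψ : TestFun A) : Prop := ∀ n V, P[n]? = some V → φ n V = ψ n V

theorem Agree.refl (P : List C) (φ : TestFun A) : Agree P φ φ := fun _ _ _ => rfl

theorem Agree.symm {P : List C} {φ ψ : TestFun A} (h : Agree P φ ψ) : Agree P ψ φ :=
  fun n V hn => (h n V hn).symm

theorem Agree.trans {P : List C} {φ ψ χ : TestFun A} (h : Agree P φ ψ) (k : Agree P ψ χ) :
    Agree P φ χ := fun n V hn => (h n V hn).trans (k n V hn)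

theorem agree_nil (φ ψ : TestFun A) : Agree [] φ ψ := by
  intro n V h
  simp at h

theorem agree_of_lt {P : List C} {φ ψ : TestFun A} (h : ∀ n, n < P.length → φ n = ψ n) :
    Agree P φ ψ := by
  intro n V hn
  obtain ⟨hn, -⟩ := List.getElem?_eq_some_iff.mp hn
  rw [h n hn]

theorem Agree.left {P Q : List C} {φ ψ : TestFun A} (h : Agree (P ++ Q) φ ψ) : Agree P φ ψ := by
  intro n V hn
  obtain ⟨hn', -⟩ := List.getElem?_eq_some_iff.mp hn
  exact h n V (by rw [List.getElem?_append_left hn', hn])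

theorem Agree.right {P Q : List C} {φ ψ : TestFun A} (h : Agree (P ++ Q) φ ψ) :
    Agree Q (fun n => φ (n + P.length)) (fun n => ψ (n + P.length)) := by
  intro n V hn
  exact h _ V (by rw [List.getElem?_append_right (by omega), Nat.add_sub_cancel, hn])

/-- The test function on a sum of words whose first summand has length `k`. -/
def glue (k : ℕ) (φ ψ : TestFun A) : TestFun A := fun n => if n < k then φ n else ψ (n - k)

theorem glue_of_lt {k n : ℕ} (h : n < k) (φ ψ : TestFun A) : glue k φ ψ n = φ n := if_pos h

theorem glue_of_le {k n : ℕ} (h : k ≤ n) (φ ψ : TestFun A) : glue k φ ψ n = ψ (n - k) :=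
  if_neg (by omega)

theorem Agree.glue {P Q : List C} {φ φ' ψ ψ' : TestFun A} (h : Agree P φ φ') (k : Agree Q ψ ψ') :
    Agree (P ++ Q) (glue P.length φ ψ) (glue P.length φ' ψ') := by
  intro n V hn
  unfold TestFun.glue
  split_ifs with hP
  · exact h n V (by rwa [List.getElem?_append_left hP] at hn)
  · exact k _ V (by rwa [List.getElem?_append_right (by omega)] at hn)

theorem glue_shift (k : ℕ) (φ : TestFun A) : glue k φ (fun n => φ (n + k)) = φ := by
  funext n
  rcases lt_or_ge n k with h | h
  · rw [glue_of_lt h]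
  · rw [glue_of_le h, Nat.sub_add_cancel h]

end TestFun

namespace Term

/-- The length of the domain of a typed term. -/
def domLen : Term C → ℕ
  | diag _ _ => 1
  | bang _ => 1
  | tape _ => 1
  | cobang _ => 0
  | codiag _ => 2
  | idLetter _ => 1
  | idZero => 0
  | swap _ _ => 2
  | comp t _ => domLen t
  | sum t s => domLen t + domLen s

/-- The length of the codomain of a typed term. -/
def codLen : Term C → ℕ
  | diag _ _ => 2
  | bang _ => 0
  | tape _ => 1
  | cobang _ => 1
  | codiag _ => 1
  | idLetter _ => 1
  | idZero => 0
  | swap _ _ => 2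
  | comp _ s => codLen s
  | sum t s => codLen t + codLen s

end Term

theorem HasType.domLen_eq {t : Term C} {P Q : List C} (h : HasType t P Q) :
    t.domLen = P.length := by
  induction h <;> simp_all [Term.domLen]

theorem HasType.codLen_eq {t : Term C} {P Q : List C} (h : HasType t P Q) :
    t.codLen = Q.length := by
  induction h <;> simp_all [Term.codLen]

namespace Term

variable {A : C}

open TestFun Classical in
/-- The transformer of a term: for `t : P → Q` it turns a test function on `Q` into one on `P`. Read
`t` as a matrix of finite subdistributions on arrows of `C`; then this is the expected value of the
test function. Values at positions and letters outside the domain of `t` carry no meaning. -/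
def sem : Term C → TestFun A → TestFun A
  | diag p _, φ => fun _ => p.1 • φ 0 + (1 - p.1) • φ 1
  | bang _, _ => 0
  | @tape _ _ U V c, φ => fun _ W f => if h : W = U then φ 0 V (f ≫ eqToHom h ≫ c) else 0
  | cobang _, _ => 0
  | codiag _, φ => fun _ => φ 0
  | idLetter _, φ => φ
  | idZero, φ => φ
  | swap _ _, φ => fun n => if n = 0 then φ 1 else φ 0
  | comp t s, φ => sem t (sem s φ)
  | sum t s, φ => glue t.domLen (sem t φ) (sem s fun n => φ (n + t.codLen))

theorem sem_linear (t : Term C) (a b : ℝ) (φ ψ : TestFun A) :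
    t.sem (a • φ + b • ψ) = a • t.sem φ + b • t.sem ψ := by
  induction t generalizing φ ψ with
  | diag p U => funext n V f; simp [sem]; ring
  | bang U => simp [sem]
  | tape c => funext n V f; simp only [sem, Pi.add_apply, Pi.smul_apply]; split_ifs <;> simp
  | cobang U => simp [sem]
  | codiag U => rfl
  | idLetter U => rfl
  | idZero => rfl
  | swap U V => funext n; simp only [sem, Pi.add_apply, Pi.smul_apply]; split_ifs <;> rfl
  | comp t s iht ihs => simp only [sem, ihs, iht]
  | sum t s iht ihs =>
    funext n
    have := ihs (fun n => φ (n + t.codLen)) (fun n => ψ (n + t.codLen))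
    simp only [sem, TestFun.glue, iht, Pi.add_apply, Pi.smul_apply]
    split_ifs
    · rfl
    · exact congrFun this _

theorem sem_zero (t : Term C) : t.sem (0 : TestFun A) = 0 := by
  simpa using t.sem_linear 0 0 (0 : TestFun A) 0

theorem sem_idW (P : List C) (φ : TestFun A) : (idW P).sem φ = φ := by
  induction P generalizing φ with
  | nil => rfl
  | cons U P ih => simp only [idW, sem, ih]; exact TestFun.glue_shift 1 φ

theorem domLen_idW (P : List C) : (idW P).domLen = P.length := (hasType_idW P).domLen_eq

theorem codLen_idW (P : List C) : (idW P).codLen = P.length := (hasType_idW P).codLen_eq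

theorem sem_bangW (P : List C) (φ : TestFun A) {n : ℕ} (hn : n < P.length) :
    (bangW P).sem φ n = 0 := by
  induction P generalizing φ n with
  | nil => simp at hn
  | cons U P ih =>
    simp only [List.length_cons] at hn
    simp only [bangW, sem, domLen]
    rcases n with _ | n
    · rfl
    · rw [TestFun.glue_of_le (by omega), ih _ (by omega)]

theorem sem_swapL (U : C) (Q : List C) (φ : TestFun A) {n : ℕ} (hn : n < Q.length + 1) :
    (swapL U Q).sem φ n = if n = 0 then φ Q.length else φ (n - 1) := by
  induction Q generalizing φ n with
  | nil => 
    obtain rfl : n = 0 := by simpa using hn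
    rfl
  | cons V Q ih =>
    simp only [List.length_cons] at hn
    simp only [swapL, sem, TestFun.glue, domLen, codLen, sem_idW, List.length_cons]
    rcases n with _ | _ | n
    · simp [ih]
    · simp
    · simp [ih _ (show n + 1 < Q.length + 1 by omega)]

theorem sem_swapW (P Q : List C) (φ : TestFun A) {n : ℕ} (hn : n < P.length + Q.length) :
    (swapW P Q).sem φ n = if n < P.length then φ (n + Q.length) else φ (n - P.length) := by
  induction P generalizing φ n with
  | nil => simp [swapW, sem_idW]
  | cons U P ih =>
    simp only [List.length_cons] at hn
    simp only [swapW, sem, TestFun.glue, domLen, codLen, sem_idW, List.length_cons,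
      (hasType_swapL U Q).domLen_eq, (hasType_swapL U Q).codLen_eq, List.length_append,
      List.length_nil, zero_add]
    rcases n with _ | n
    · simp [sem_swapL]
    · simp only [Nat.add_sub_cancel, show ¬ (n + 1 < 1) by omega, if_false,
        ih _ (show n < P.length + Q.length by omega)]
      by_cases h : n < P.length
      · simp only [h, if_true, show n + 1 < P.length + 1 by omega]
        rw [if_neg (by omega)]
        congr 1
        omega
      · simp only [h, if_false, show ¬ (n + 1 < P.length + 1) by omega]
        rw [if_pos (by omega), sem_swapL _ _ _ (by omega), if_neg (by omega)]
        congr 1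
        omega

theorem sem_diagW (p : OpenUnit) (P : List C) (φ : TestFun A) {n : ℕ} (hn : n < P.length) :
    (diagW p P).sem φ n = p.1 • φ n + (1 - p.1) • φ (n + P.length) := by
  induction P generalizing φ n with
  | nil => simp at hn
  | cons U P ih =>
    simp only [List.length_cons] at hn
    simp only [diagW, sem, domLen, codLen, List.length_cons, sem_idW,
      (hasType_swapW [U] P).domLen_eq, (hasType_swapW [U] P).codLen_eq, List.length_append,
      List.length_nil, zero_add]
    rcases n with _ | n
    · rw [TestFun.glue_of_lt (by omega), TestFun.glue_of_lt (by omega),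
        TestFun.glue_of_le (by omega), TestFun.glue_of_lt (by omega), sem_swapW _ _ _ (by simp)]
      simp
    · rw [TestFun.glue_of_le (by omega), ih _ (by omega), TestFun.glue_of_le (by omega),
        TestFun.glue_of_lt (by omega), TestFun.glue_of_le (by omega),
        TestFun.glue_of_le (by omega), sem_swapW _ _ _ (by simp; omega)]
      simp only [List.length_cons, List.length_nil]
      rw [if_neg (by omega)]
      congr 3 
      omega

theorem sem_codiagW (P : List C) (φ : TestFun A) {n : ℕ} (hn : n < P.length + P.length) :
    (codiagW P).sem φ n = if n < P.length then φ n else φ (n - P.length) := by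
  induction P generalizing φ n with
  | nil => simp at hn
  | cons U P ih =>
    simp only [List.length_cons] at hn
    simp only [codiagW, sem, domLen, codLen, List.length_cons, sem_idW,
      (hasType_swapW P [U]).domLen_eq, (hasType_swapW P [U]).codLen_eq, List.length_append,
      List.length_nil, zero_add]
    rcases n with _ | n
    · rw [TestFun.glue_of_lt (by omega), TestFun.glue_of_lt (by omega), if_pos (by omega)]
    · rw [TestFun.glue_of_le (by omega), Nat.add_sub_cancel]
      rcases lt_or_ge n (P.length + 1) with h | h
      · rw [TestFun.glue_of_lt h, sem_swapW _ _ _ (by simpa using h)]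
        simp only [List.length_cons, List.length_nil]
        split_ifs with h₁ h₂ h₂
        · rw [TestFun.glue_of_le (by omega), ih _ (by omega), if_pos (by omega)]
          congr 1
        · omega
        · omega
        · rw [TestFun.glue_of_lt (by omega)]
          congr 1
          omega
      · rw [TestFun.glue_of_le h, TestFun.glue_of_le (by omega), ih _ (by omega),
          if_neg (by omega), if_neg (by omega)]
        congr 1
        omega

end Term

open TestFun Term

theorem HasType.sem_agree {A : C} {t : Term C} {P Q : List C} (h : HasType t P Q)
    {φ ψ : TestFun A} (hφ : Agree Q φ ψ) : Agree P (t.sem φ) (t.sem ψ) := by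
  induction h generalizing φ ψ with
  | diag p U =>
    intro n V hn
    obtain ⟨rfl, rfl⟩ : n = 0 ∧ U = V := by
      rcases n with _ | n <;> simp_all
    simp [sem, hφ 0 U rfl, hφ 1 U rfl]
  | bang U => exact .refl _ _
  | tape c =>
    intro n W hn
    funext f
    simp only [sem]
    rw [hφ 0 _ rfl]
  | cobang U => exact .refl _ _
  | codiag U =>
    intro n V hn
    have : V = U := by
      rcases n with _ | _ | n <;> simp_all
    subst this
    exact hφ 0 V rfl
  | idLetter U => exact hφ
  | idZero => exact hφ
  | swap U V =>
    intro n W hn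
    rcases n with _ | _ | n
    · exact hφ 1 W (by simpa using hn)
    · exact hφ 0 W (by simpa using hn)
    · simp at hn
  | comp _ _ iht ihs => exact iht (ihs hφ)
  | sum ht hs iht ihs =>
    simp only [sem, ht.domLen_eq, ht.codLen_eq]
    exact (iht hφ.left).glue (ihs hφ.right)

/-- Soundness: provably equal terms have the same transformer. -/
theorem TapeEq.sem_agree {A : C} {t s : Term C} {P Q : List C} (h : TapeEq P Q t s)
    (φ : TestFun A) : Agree P (t.sem φ) (s.sem φ) := by
  induction h generalizing φ with
  | refl h => exact .refl _ _
  | symm _ ih => exact (ih φ).symm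
  | trans _ _ ih₁ ih₂ => exact (ih₁ φ).trans (ih₂ φ)
  | comp_congr h₁ _ ih₁ ih₂ => exact (h₁.hasType.1.sem_agree (ih₂ φ)).trans (ih₁ _)
  | sum_congr h₁ _ ih₁ ih₂ =>
    simp only [sem, h₁.hasType.1.domLen_eq, h₁.hasType.2.domLen_eq, h₁.hasType.1.codLen_eq,
      h₁.hasType.2.codLen_eq]
    exact (ih₁ _).glue (ih₂ _)
  | comp_assoc => exact .refl _ _
  | id_comp h => simp only [sem, sem_idW]; exact .refl _ _
  | comp_id h => simp only [sem, sem_idW]; exact .refl _ _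
  | interchange h₁ h₂ h₃ h₄ =>
    simp only [sem, h₁.domLen_eq, h₁.codLen_eq, h₂.domLen_eq, h₂.codLen_eq, domLen, codLen]
    refine (h₁.sem_agree (agree_of_lt fun n hn => ?_)).glue
      (h₃.sem_agree (agree_of_lt fun n hn => ?_))
    · exact if_pos hn
    · simp [glue]
  | zero_sum h => simp only [sem, domLen, codLen]; exact .refl _ _
  | @sum_zero f P Q h =>
    simp only [sem, h.domLen_eq, h.codLen_eq]
    exact agree_of_lt fun n hn => if_pos hn
  | @sum_assoc f g h P₁ Q₁ P₂ Q₂ P₃ Q₃ h₁ h₂ h₃ =>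
    simp only [sem, h₁.domLen_eq, h₁.codLen_eq, h₂.domLen_eq, h₂.codLen_eq, domLen, codLen]
    refine agree_of_lt fun n hn => ?_
    unfold glue
    by_cases k₁ : n < P₁.length
    · rw [if_pos (by omega), if_pos k₁, if_pos k₁]
    · by_cases k₂ : n - P₁.length < P₂.length
      · rw [if_pos (by omega), if_neg k₁, if_pos k₂, if_neg k₁]
      · rw [if_neg (by omega), if_neg k₁, if_neg k₂]
        congr 1
        · funext m
          rw [add_assoc, add_comm Q₁.length]
        · omega
  | swap_swap P Q =>
    simp only [sem, sem_idW]
    refine agree_of_lt fun n hn => ?_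
    simp only [List.length_append] at hn
    rw [sem_swapW _ _ _ hn]
    split_ifs with h
    · rw [sem_swapW _ _ _ (by omega), if_neg (by omega), Nat.add_sub_cancel]
    · rw [sem_swapW _ _ _ (by omega), if_pos (by omega), Nat.sub_add_cancel (by omega)]
  | @swap_nat s P Q R h =>
    have e : Agree Q ((swapW Q R).sem φ) (fun n => φ (n + R.length)) :=
      agree_of_lt fun n hn => by rw [sem_swapW _ _ _ (by omega), if_pos hn]
    simp only [sem, sem_idW, h.domLen_eq, h.codLen_eq, domLen_idW, codLen_idW]
    refine ((h.sem_agree e).glue (.refl R _)).trans (agree_of_lt fun n hn => ?_)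
    simp only [List.length_append] at hn
    rw [sem_swapW _ _ _ hn]
    rcases lt_or_ge n P.length with k | k
    · rw [glue_of_lt k, if_pos k, glue_of_le (by omega), Nat.add_sub_cancel]
    · rw [glue_of_le k, if_neg (by omega), glue_of_lt (by omega), sem_swapW _ _ _ (by omega),
        if_neg (by omega), Nat.add_sub_cancel]
  | codiag_assoc P =>
    simp only [sem, sem_idW, domLen_idW, codLen_idW, (hasType_codiagW P).domLen_eq,
      (hasType_codiagW P).codLen_eq]
    refine agree_of_lt fun n hn => ?_
    simp only [List.length_append] at hn ⊢
    rcases lt_or_ge n P.length with k₁ | k₁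
    · rw [glue_of_lt k₁, glue_of_lt (by omega), sem_codiagW _ _ (by omega), if_pos k₁,
        sem_codiagW _ _ (by omega), if_pos k₁, sem_codiagW _ _ (by omega), if_pos k₁]
    rw [glue_of_le k₁, sem_codiagW _ _ (by omega)]
    rcases lt_or_ge n (P.length + P.length) with k₂ | k₂
    · rw [if_pos (by omega), glue_of_lt k₂, sem_codiagW _ _ (by omega), if_neg (by omega),
        sem_codiagW _ _ (by omega), if_neg (by omega), sem_codiagW _ _ (by omega),
        if_pos (by omega), Nat.add_sub_cancel]
    · rw [if_neg (by omega), glue_of_le k₂, sem_codiagW _ _ (by omega), if_neg (by omega),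
        sem_codiagW _ _ (by omega), if_neg (by omega)]
      congr 1
      omega
  | codiag_unit P =>
    simp only [sem, sem_idW, (hasType_cobangW P).domLen_eq, (hasType_cobangW P).codLen_eq]
    refine agree_of_lt fun n hn => ?_
    simp only [glue, List.length_nil, Nat.not_lt_zero, if_false, Nat.sub_zero]
    rw [sem_codiagW _ _ (by omega), if_neg (by omega), Nat.add_sub_cancel]
  | cobang_zero => exact agree_nil _ _
  | codiag_zero => exact agree_nil _ _
  | codiag_swap P =>
    simp only [sem]
    refine agree_of_lt fun n hn => ?_
    simp only [List.length_append] at hn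
    rw [sem_swapW _ _ _ hn, sem_codiagW _ _ hn]
    split_ifs with h
    · rw [sem_codiagW _ _ (by omega), if_neg (by omega), Nat.add_sub_cancel]
    · rw [sem_codiagW _ _ (by omega), if_pos (by omega)]
  | cobang_coh P Q => exact agree_nil _ _
  | codiag_coh P Q =>
    simp only [sem, sem_idW, domLen_idW, codLen_idW, (hasType_codiagW P).domLen_eq,
      (hasType_codiagW P).codLen_eq, (hasType_swapW Q P).domLen_eq, (hasType_swapW Q P).codLen_eq]
    refine agree_of_lt fun n hn => ?_
    simp only [List.length_append] at hn
    rw [sem_codiagW _ _ (by simpa using hn)]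
    simp only [List.length_append, glue]
    by_cases k₁ : n < P.length
    · rw [if_pos (by omega), if_pos k₁, if_pos (by omega), sem_codiagW _ _ (by omega), if_pos k₁]
    rw [if_neg k₁]
    by_cases k₂ : n < P.length + Q.length
    · rw [if_pos k₂, if_pos (by omega), sem_swapW _ _ _ (by omega), if_pos (by omega),
        if_neg (by omega), sem_codiagW _ _ (by omega), if_pos (by omega)]
      congr 1
      omega
    rw [if_neg k₂]
    by_cases k₃ : n < P.length + Q.length + P.length
    · rw [if_pos (by omega), sem_swapW _ _ _ (by omega), if_neg (by omega),
        if_pos (by omega), sem_codiagW _ _ (by omega), if_neg (by omega)]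
      congr 1
      omega
    · rw [if_neg (by omega), if_neg (by omega), sem_codiagW _ _ (by omega), if_neg (by omega)]
      congr 1
      omega
  | cobang_nat h => exact agree_nil _ _
  | @codiag_nat f P Q h =>
    simp only [sem, h.domLen_eq, h.codLen_eq]
    have e₁ : Agree Q φ ((codiagW Q).sem φ) :=
      agree_of_lt fun n hn => by rw [sem_codiagW _ _ (by omega), if_pos hn]
    have e₂ : Agree Q φ (fun n => (codiagW Q).sem φ (n + Q.length)) :=
      agree_of_lt fun n hn => by
        rw [sem_codiagW _ _ (by omega), if_neg (by omega), Nat.add_sub_cancel]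
    refine Agree.trans (agree_of_lt fun n hn => ?_) ((h.sem_agree e₁).glue (h.sem_agree e₂))
    simp only [List.length_append] at hn
    exact sem_codiagW _ _ hn
  | diag_assoc p q P =>
    simp only [sem, sem_idW, domLen_idW, codLen_idW, (hasType_diagW _ P).domLen_eq,
      (hasType_diagW _ P).codLen_eq]
    refine agree_of_lt fun n hn => ?_
    rw [sem_diagW _ _ _ hn, sem_diagW _ _ _ hn]
    simp only [glue]
    rw [if_pos hn, if_pos hn, if_neg (by omega), if_neg (by omega), Nat.add_sub_cancel,
      sem_diagW _ _ _ hn, sem_diagW _ _ _ hn]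
    have hpq : 1 - p.1 * q.1 ≠ 0 := by have := (OpenUnit.mul_mem p q).2; linarith
    funext V f
    simp only [OpenUnit.tildeP, OpenUnit.tildeQ, Pi.add_apply, Pi.smul_apply, smul_eq_mul,
      List.length_append, add_assoc]
    field_simp
    ring
  | diag_idem p P =>
    simp only [sem, sem_idW]
    refine agree_of_lt fun n hn => ?_
    rw [sem_diagW _ _ _ hn, sem_codiagW _ _ (by omega), sem_codiagW _ _ (by omega), if_pos hn,
      if_neg (by omega), Nat.add_sub_cancel, ← add_smul]
    simp
  | diag_swap p P =>
    simp only [sem]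
    refine agree_of_lt fun n hn => ?_
    rw [sem_diagW _ _ _ hn, sem_diagW _ _ _ hn, sem_swapW _ _ _ (by omega),
      sem_swapW _ _ _ (by omega), if_pos hn, if_neg (by omega), Nat.add_sub_cancel, add_comm]
    simp [OpenUnit.compl]
  | diag_zero p => exact agree_nil _ _
  | bang_zero => exact agree_nil _ _
  | bang_coh P Q =>
    refine agree_of_lt fun n hn => ?_
    simp only [sem, glue, (hasType_bangW P).domLen_eq]
    rw [sem_bangW _ _ hn]
    simp only [List.length_append] at hn
    split_ifs with h
    · rw [sem_bangW _ _ h]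
    · rw [sem_bangW _ _ (by omega)]
  | diag_coh p P Q =>
    simp only [sem, sem_idW, domLen_idW, codLen_idW, (hasType_diagW p P).domLen_eq,
      (hasType_diagW p P).codLen_eq, (hasType_swapW P Q).domLen_eq, (hasType_swapW P Q).codLen_eq]
    refine agree_of_lt fun n hn => ?_
    rw [sem_diagW _ _ _ hn]
    simp only [List.length_append] at hn ⊢
    rcases lt_or_ge n P.length with h | h
    · rw [glue_of_lt h, sem_diagW _ _ _ h, glue_of_lt h, glue_of_le (by omega),
        glue_of_lt (by omega), sem_swapW _ _ _ (by omega), if_pos (by omega)]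
      congr 3
      omega
    · rw [glue_of_le h, sem_diagW _ _ _ (by omega), glue_of_le (by omega), glue_of_lt (by omega),
        glue_of_le (by omega), glue_of_le (by omega), sem_swapW _ _ _ (by omega),
        if_neg (by omega)]
      congr 3 <;> omega
  | @bang_nat f P Q h =>
    have e : Agree Q ((bangW Q).sem φ) 0 := agree_of_lt fun n hn => sem_bangW _ _ hn
    refine (h.sem_agree e).trans (agree_of_lt fun n hn => ?_)
    rw [sem_zero, sem_bangW _ _ hn]
    rfl
  | @diag_nat f P Q p h =>
    have e : Agree Q ((diagW p Q).sem φ) (p.1 • φ + (1 - p.1) • fun n => φ (n + Q.length)) :=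
      agree_of_lt fun n hn => sem_diagW _ _ _ hn
    refine (h.sem_agree e).trans (agree_of_lt fun n hn => ?_)
    rw [sem_linear]
    simp only [sem, h.domLen_eq, h.codLen_eq]
    rw [sem_diagW _ _ _ hn]
    simp [glue, hn]
  | tape_id U =>
    intro n V hn
    obtain ⟨rfl, rfl⟩ : n = 0 ∧ U = V := by
      rcases n with _ | n <;> simp_all
    funext f
    simp [sem, sem_idW]
  | @tape_comp U V W c d =>
    intro n V' hn
    obtain ⟨rfl, rfl⟩ : n = 0 ∧ U = V' := by
      rcases n with _ | n <;> simp_all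
    funext f
    simp [sem]

/-! ### Injections of single letters -/

section Positions

variable {D : Type u}

/-- The occurrences of the letter `V` in a word. -/
inductive Letter (V : D) : List D → Type u
  | head (P : List D) : Letter V (V :: P)
  | tail (W : D) {P : List D} : Letter V P → Letter V (W :: P)

namespace Letter

variable {V : D}

/-- The position of an occurrence. -/
def idx : ∀ {P : List D}, Letter V P → ℕ
  | _, head _ => 0
  | _, tail _ m => m.idx + 1

theorem idx_injective {P : List D} (m m' : Letter V P) (h : m.idx = m'.idx) : m = m' := by
  induction m with
  | head P =>
    cases m' with
    | head => rfl
    | tail _ m' => simp [idx] at h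
  | tail W m ih =>
    cases m' with
    | head => simp [idx] at h
    | tail _ m' => rw [ih m' (by simpa [idx] using h)]

end Letter

end Positions

namespace Tape

variable {P Q R : Tape C}

/-- The word that consists of one letter. -/
def letter (U : C) : Tape C := ([U] : List C)

theorem assocHom_letter (U : C) (Q R : Tape C) : assocHom (letter U) Q R = 𝟙 _ := rfl

theorem ι₁_assocHom (P Q R : Tape C) :
    ι₁ (oplus P Q) R ≫ assocHom P Q R = sumHom (𝟙 P) (ι₁ Q R) := by
  refine (comp_assocHom (((hasType_idW (oplus P Q)).sum (hasType_cobangW R)).cast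
    (List.append_nil _) rfl)).trans (TapeHom.mk_eq ?_)
  have h := TapeEq.sum_congr (TapeEq.idW_append P Q).symm (.refl (hasType_cobangW R))
  have k := TapeEq.sum_assoc (hasType_idW P) (hasType_idW Q) (hasType_cobangW R)
  exact (h.trans k).cast (List.append_nil _) (List.append_assoc _ _ _)

theorem ι₂_assocHom (P Q R : Tape C) :
    ι₂ (oplus P Q) R ≫ assocHom P Q R = ι₂ Q R ≫ ι₂ P (oplus Q R) := by
  have tP := hasType_cobangW P
  have tQ := (hasType_cobangW Q).sum (hasType_idW R)
  have tQR := hasType_idW (oplus Q R)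
  refine (comp_assocHom ((hasType_cobangW (oplus P Q)).sum (hasType_idW R))).trans
    (TapeHom.mk_eq ?_)
  have h := TapeEq.sum_congr (TapeEq.cobang_coh P Q) (.refl (hasType_idW R))
  have k := TapeEq.sum_assoc tP (hasType_cobangW Q) (hasType_idW R)
  have l := TapeEq.interchange .idZero tP tQ tQR
  have l' := TapeEq.sum_congr (TapeEq.id_comp tP) (TapeEq.comp_id tQ)
  have l'' := TapeEq.comp_congr (TapeEq.zero_sum tQ) (.refl (tP.sum tQR))
  exact ((h.trans k).cast rfl (List.append_assoc _ _ _)).trans ((l.trans l').symm.trans l'')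

theorem ι₁_letter_oplus (U : C) (P Q : Tape C) :
    ι₁ (oplus (letter U) P) Q = sumHom (𝟙 (letter U)) (ι₁ P Q) := by
  rw [← ι₁_assocHom, assocHom_letter]
  exact (Category.comp_id _).symm

theorem ι₂_letter_oplus (U : C) (P Q : Tape C) :
    ι₂ (oplus (letter U) P) Q = ι₂ P Q ≫ ι₂ (letter U) (oplus P Q) := by
  rw [← ι₂_assocHom, assocHom_letter]
  exact (Category.comp_id _).symm

theorem ι₁_ι₁_letter (U : C) (P Q : Tape C) :
    ι₁ (letter U) P ≫ ι₁ (oplus (letter U) P) Q = ι₁ (letter U) (oplus P Q) := by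
  rw [ι₁_letter_oplus]
  exact (ι₁_sumHom _ _).trans (Category.id_comp _)

theorem comp_ι₁_ι₂_letter (W : C) (k : R ⟶ P) : (k ≫ ι₁ P Q) ≫ ι₂ (letter W) (oplus P Q) =
    (k ≫ ι₂ (letter W) P) ≫ ι₁ (oplus (letter W) P) Q := by
  have h : ι₁ P Q ≫ ι₂ (letter W) (oplus P Q) = ι₂ (letter W) P ≫ ι₁ (oplus (letter W) P) Q := by
    rw [ι₁_letter_oplus]
    exact (ι₂_sumHom _ _).symm
  exact (Category.assoc _ _ _).trans ((congrArg (k ≫ ·) h).trans (Category.assoc _ _ _).symm)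

theorem comp_ι₂_ι₂_letter (W : C) (k : R ⟶ Q) : (k ≫ ι₂ P Q) ≫ ι₂ (letter W) (oplus P Q) =
    k ≫ ι₂ (oplus (letter W) P) Q := by
  rw [ι₂_letter_oplus, Category.assoc]
  rfl

theorem ι₁_zero (U : C) : ι₁ (letter U) zero = 𝟙 (letter U) :=
  TapeHom.mk_eq (TapeEq.sum_zero (hasType_idW [U]))

theorem comp_ι₂_zero (k : R ⟶ P) : k ≫ ι₂ zero P = k := by
  have h : ι₂ zero P = 𝟙 P := TapeHom.mk_eq (TapeEq.zero_sum (hasType_idW P))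
  exact (congrArg (k ≫ ·) h).trans (Category.comp_id k)

end Tape

namespace Letter

variable {V : C}

/-- The injection of a single letter into a word. -/
def inj : ∀ {P : List C}, Letter V P → (Tape.letter V ⟶ P)
  | _, head P => Tape.ι₁ (Tape.letter V) P
  | _, tail W (P := P) m => m.inj ≫ Tape.ι₂ (Tape.letter W) P

theorem exists_inj_comp_ι₁ {P : List C} (m : Letter V P) (Q : List C) :
    ∃ m' : Letter V (P ++ Q), m.inj ≫ Tape.ι₁ P Q = m'.inj := by
  induction m with
  | head P => exact ⟨head (P ++ Q), Tape.ι₁_ι₁_letter V P Q⟩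
  | @tail W P m ih =>
    obtain ⟨m', h⟩ := ih
    exact ⟨tail W m', (Tape.comp_ι₁_ι₂_letter W m.inj).symm.trans
      (congrArg (· ≫ Tape.ι₂ (Tape.letter W) (Tape.oplus P Q)) h)⟩

theorem exists_inj_comp_ι₂ {Q : List C} (m : Letter V Q) (P : List C) :
    ∃ m' : Letter V (P ++ Q), m.inj ≫ Tape.ι₂ P Q = m'.inj := by
  induction P with
  | nil => exact ⟨m, Tape.comp_ι₂_zero m.inj⟩
  | cons W P ih =>
    obtain ⟨m', h⟩ := ih
    exact ⟨tail W m', (Tape.comp_ι₂_ι₂_letter (P := P) W m.inj).symm.trans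
      (congrArg (· ≫ Tape.ι₂ (Tape.letter W) (Tape.oplus P Q)) h)⟩

/-- A letter of a sum of words is a letter of one of the summands. -/
theorem inj_append {P Q : List C} (m : Letter V (P ++ Q)) :
    (∃ k : Letter V P, m.inj = k.inj ≫ Tape.ι₁ P Q) ∨
      ∃ k : Letter V Q, m.inj = k.inj ≫ Tape.ι₂ P Q := by
  induction P with
  | nil => exact Or.inr ⟨m, (Tape.comp_ι₂_zero (inj (P := Q) m)).symm⟩
  | cons W P ih =>
    cases m with
    | head => exact Or.inl ⟨head P, (Tape.ι₁_ι₁_letter V P Q).symm⟩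
    | tail _ m =>
      rcases ih m with ⟨k, hk⟩ | ⟨k, hk⟩
      · exact Or.inl ⟨tail W k, (congrArg (· ≫ Tape.ι₂ (Tape.letter W) (Tape.oplus P Q)) hk).trans
          (Tape.comp_ι₁_ι₂_letter W k.inj)⟩
      · exact Or.inr ⟨k, (congrArg (· ≫ Tape.ι₂ (Tape.letter W) (Tape.oplus P Q)) hk).trans
          (Tape.comp_ι₂_ι₂_letter (P := P) W k.inj)⟩

end Letter

/-! ### Generation of homsets by convex combinations -/

namespace Tape

variable {P Q R : Tape C}

/-- The arrow of `T(C)` given by an arrow of `C`. -/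
def tape {U V : C} (c : U ⟶ V) : letter U ⟶ letter V :=
  TapeHom.mk (Term.tape c) (.tape c)

theorem tape_id (U : C) : tape (𝟙 U) = 𝟙 (letter U) := TapeHom.mk_eq (.tape_id U)

theorem tape_comp {U V W : C} (c : U ⟶ V) (d : V ⟶ W) : tape (c ≫ d) = tape c ≫ tape d :=
  TapeHom.mk_eq (.tape_comp c d)

/-- The convex generators of the homset `U ⟶ Q`: the point `⋆` and, for every letter `V` of `Q` and
every arrow `c : U ⟶ V` of `C`, the arrow `c` followed by the injection of that letter. -/
def generator (U : C) (Q : Tape C) :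
    Option (Σ V : C, Letter V Q × (U ⟶ V)) → (letter U ⟶ Q)
  | none => (homOps C (letter U) Q).star
  | some x => tape x.2.2 ≫ x.2.1.inj

/-- Every letter of the domain is sent to a convex combination of generators. -/
def Generated (f : P ⟶ Q) : Prop :=
  ∀ (U : C) (m : Letter U P), (homOps C (letter U) Q).Hull (generator U Q) (m.inj ≫ f)

theorem hull_star (U : C) (Q : Tape C) :
    (homOps C (letter U) Q).Hull (generator U Q) (homOps C (letter U) Q).star := .gen none

theorem hull_inj {U : C} {Q : Tape C} (m : Letter U Q) :
    (homOps C (letter U) Q).Hull (generator U Q) m.inj := by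
  have h := PCAOps.Hull.gen (A := homOps C (letter U) Q) (e := generator U Q) (some ⟨U, m, 𝟙 U⟩)
  simpa only [generator, tape_id, Category.id_comp] using h

theorem hull_tape_comp {U V : C} (c : U ⟶ V) {f : letter V ⟶ Q}
    (hf : (homOps C (letter V) Q).Hull (generator V Q) f) :
    (homOps C (letter U) Q).Hull (generator U Q) (tape c ≫ f) := by
  induction hf with
  | gen i =>
    rcases i with _ | ⟨W, m, d⟩
    · simp only [generator]
      rw [isPCAEnriched.comp_star]
      exact hull_star U Q
    · simp only [generator]
      rw [← Category.assoc, ← tape_comp]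
      exact PCAOps.Hull.gen (e := generator U Q) (some ⟨W, m, c ≫ d⟩)
  | conv p _ _ ih₁ ih₂ =>
    rw [isPCAEnriched.comp_conv]
    exact .conv p ih₁ ih₂

theorem hull_comp {U : C} {f : letter U ⟶ P} {g : P ⟶ Q}
    (hf : (homOps C (letter U) P).Hull (generator U P) f) (hg : Generated g) :
    (homOps C (letter U) Q).Hull (generator U Q) (f ≫ g) := by
  induction hf with
  | gen i =>
    rcases i with _ | ⟨W, m, d⟩
    · simp only [generator]
      rw [isPCAEnriched.star_comp]
      exact hull_star U Q
    · simp only [generator]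
      rw [Category.assoc]
      exact hull_tape_comp d (hg W m)
  | conv p _ _ ih₁ ih₂ =>
    rw [isPCAEnriched.conv_comp]
    exact .conv p ih₁ ih₂

theorem Generated.comp {f : P ⟶ Q} {g : Q ⟶ R} (hf : Generated f) (hg : Generated g) :
    Generated (f ≫ g) := by
  intro U m
  rw [← Category.assoc]
  exact hull_comp (hf U m) hg

theorem generated_ι₁ (P Q : Tape C) : Generated (ι₁ P Q) := by
  intro U m
  obtain ⟨m', h⟩ := m.exists_inj_comp_ι₁ Q
  exact h ▸ hull_inj (Q := oplus P Q) m'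

theorem generated_ι₂ (P Q : Tape C) : Generated (ι₂ P Q) := by
  intro U m
  obtain ⟨m', h⟩ := m.exists_inj_comp_ι₂ P
  exact h ▸ hull_inj (Q := oplus P Q) m'

theorem generated_oplus {f : oplus P Q ⟶ R} (h₁ : Generated (ι₁ P Q ≫ f))
    (h₂ : Generated (ι₂ P Q ≫ f)) : Generated f := by
  intro U m
  rcases Letter.inj_append (P := P) (Q := Q) m with ⟨k, hk⟩ | ⟨k, hk⟩
  · have h := h₁ U k
    rw [← Category.assoc, ← hk] at h
    exact h
  · have h := h₂ U k
    rw [← Category.assoc, ← hk] at h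
    exact h

theorem generated_letter {U : C} {f : letter U ⟶ Q} :
    Generated f ↔ (homOps C (letter U) Q).Hull (generator U Q) f := by
  have h : Letter.inj (P := letter U) (.head []) = 𝟙 (letter U) := ι₁_zero U
  constructor
  · intro hf
    have h' := hf U (.head [])
    rwa [h, Category.id_comp] at h'
  · intro hf V m
    cases m with
    | head =>
      rw [h, Category.id_comp]
      exact hf
    | tail _ m => cases m

theorem generated_id (P : Tape C) : Generated (𝟙 P) := by
  intro U m
  rw [Category.comp_id]
  exact hull_inj m

theorem generated_conv (p : OpenUnit) {f g : P ⟶ Q} (hf : Generated f) (hg : Generated g) :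
    Generated ((homOps C P Q).conv p f g) := by
  intro U m
  rw [isPCAEnriched.comp_conv]
  exact .conv p (hf U m) (hg U m)

theorem generated_diag (p : OpenUnit) (P : Tape C) : Generated (diag p P) := by
  rw [diag_eq_conv]
  exact generated_conv p (generated_ι₁ _ _) (generated_ι₂ _ _)

theorem generated_bang (f : P ⟶ zero) : Generated f := by
  intro U m
  rw [hom_ext_zero_right (m.inj ≫ f) (homOps C (letter U) zero).star]
  exact hull_star U zero

theorem generated_tape {U V : C} (c : U ⟶ V) : Generated (tape c) := by
  have h := hull_tape_comp c (generated_letter.mp (generated_id (letter V)))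
  rw [Category.comp_id] at h
  exact generated_letter.mpr h

theorem generated_codiag (P : Tape C) : Generated (codiag P) := by
  apply generated_oplus
  · rw [ι₁_codiag]; exact generated_id _
  · rw [ι₂_codiag]; exact generated_id _

theorem generated_swap (P Q : Tape C) : Generated (swap P Q) := by
  apply generated_oplus
  · rw [ι₁_swap]; exact generated_ι₂ _ _
  · rw [ι₂_swap]; exact generated_ι₁ _ _

theorem generated_sumHom {P₁ Q₁ P₂ Q₂ : Tape C} {f : P₁ ⟶ Q₁} {g : P₂ ⟶ Q₂} (hf : Generated f)
    (hg : Generated g) : Generated (sumHom f g) := by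
  apply generated_oplus
  · rw [ι₁_sumHom]; exact hf.comp (generated_ι₁ _ _)
  · rw [ι₂_sumHom]; exact hg.comp (generated_ι₂ _ _)

theorem generated_mk {t : Term C} {P Q : List C} (h : HasType t P Q) :
    Generated (P := P) (Q := Q) (TapeHom.mk t h) := by
  induction h with
  | diag p U => exact TapeHom.mk_eq (TapeEq.diagW_singleton p U) ▸ generated_diag p (letter U)
  | bang U => exact generated_bang (TapeHom.mk (Term.bang U) (.bang U))
  | tape c => exact generated_tape c
  | cobang U => intro V m; cases m
  | codiag U => exact TapeHom.mk_eq (TapeEq.codiagW_singleton U) ▸ generated_codiag (letter U)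
  | idLetter U => exact TapeHom.mk_eq (TapeEq.idW_singleton U) ▸ generated_id (letter U)
  | idZero => intro V m; cases m
  | swap U V =>
    exact TapeHom.mk_eq (TapeEq.swapW_singleton U V) ▸ generated_swap (letter U) (letter V)
  | comp _ _ iht ihs => exact Generated.comp iht ihs
  | sum _ _ iht ihs => exact generated_sumHom iht ihs

theorem hull_generator {U : C} (f : letter U ⟶ Q) :
    (homOps C (letter U) Q).Hull (generator U Q) f := by
  obtain ⟨t, h, rfl⟩ := TapeHom.exists_mk f
  exact generated_letter.mp (generated_mk h)

/-! ### Cancellation of scalars -/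

/-- The expected value of the test function `φ` under an arrow whose domain is a single letter. -/
def val {U : C} (φ : TestFun U) (f : letter U ⟶ Q) : ℝ :=
  Quotient.lift (fun t : {t : Term C // HasType t [U] Q} => t.1.sem φ 0 U (𝟙 U))
    (fun a b (h : TapeEq [U] Q a.1 b.1) => congrFun (h.sem_agree φ 0 U rfl) (𝟙 U)) f

theorem val_star {U : C} (φ : TestFun U) : val φ (homOps C (letter U) Q).star = 0 :=
  congrFun (congrFun (Term.sem_bangW [U] ((Term.cobangW Q).sem φ) (n := 0) (by simp)) U) (𝟙 U)

theorem sem_diagW_sum_codiagW {U : C} {Q : List C} (p : OpenUnit) {a b : Term C}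
    (ha : HasType a [U] Q) (hb : HasType b [U] Q) (φ : TestFun U) :
    ((Term.diagW p [U]).comp ((a.sum b).comp (Term.codiagW Q))).sem φ 0 U (𝟙 U) =
      p.1 * a.sem φ 0 U (𝟙 U) + (1 - p.1) * b.sem φ 0 U (𝟙 U) := by
  have e₁ : TestFun.Agree Q ((Term.codiagW Q).sem φ) φ :=
    TestFun.agree_of_lt fun n hn => by rw [Term.sem_codiagW _ _ (by omega), if_pos hn]
  have e₂ : TestFun.Agree Q (fun n => (Term.codiagW Q).sem φ (n + Q.length)) φ :=
    TestFun.agree_of_lt fun n hn => by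
      rw [Term.sem_codiagW _ _ (by omega), if_neg (by omega), Nat.add_sub_cancel]
  have f₁ := congrFun (ha.sem_agree e₁ 0 U rfl) (𝟙 U)
  have f₂ := congrFun (hb.sem_agree e₂ 0 U rfl) (𝟙 U)
  rw [Term.sem, Term.sem_diagW _ _ _ (by simp)]
  simp only [Term.sem, ha.domLen_eq, ha.codLen_eq, List.length_cons, List.length_nil, zero_add,
    Pi.add_apply, Pi.smul_apply, smul_eq_mul]
  rw [TestFun.glue_of_lt (by omega), TestFun.glue_of_le (by omega), f₁, Nat.sub_self, f₂]

theorem val_isAffine {U : C} (φ : TestFun U) : (homOps C (letter U) Q).IsAffine (val φ) := by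
  intro p f g
  obtain ⟨a, ha, rfl⟩ := TapeHom.exists_mk f
  obtain ⟨b, hb, rfl⟩ := TapeHom.exists_mk g
  exact sem_diagW_sum_codiagW p ha hb φ

theorem sem_cobangW_sum_idW {U W : C} (Q : List C) (φ : TestFun U) :
    ((Term.cobangW [W]).sum (Term.idW Q)).sem φ = fun n => φ (n + 1) := by
  simp only [Term.sem, (hasType_cobangW [W]).domLen_eq, (hasType_cobangW [W]).codLen_eq,
    Term.sem_idW]
  funext n
  exact TestFun.glue_of_le (Nat.zero_le n) _ _

theorem val_comp_ι₂ {U W : C} (φ : TestFun U) (f : letter U ⟶ Q) :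
    val φ (f ≫ ι₂ (letter W) Q) = val (fun n => φ (n + 1)) f := by
  obtain ⟨a, ha, rfl⟩ := TapeHom.exists_mk f
  exact congrArg (fun ψ => a.sem ψ 0 U (𝟙 U)) (sem_cobangW_sum_idW Q φ)

theorem val_tape_ι₁ {U V : C} (φ : TestFun U) (c : U ⟶ V) (Q : Tape C) :
    val φ (tape c ≫ ι₁ (letter V) Q) = φ 0 V c := by
  change ((Term.tape c).comp ((Term.idW [V]).sum (Term.cobangW Q))).sem φ 0 U (𝟙 U) = _
  simp only [Term.sem, Term.sem_idW, Term.domLen_idW, dif_pos, eqToHom_refl, Category.id_comp]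
  rw [TestFun.glue_of_lt (by simp)]

theorem val_tape_inj {U V : C} (φ : TestFun U) (c : U ⟶ V) {Q : List C} (m : Letter V Q) :
    val φ (tape c ≫ m.inj) = φ m.idx V c := by
  induction m generalizing φ with
  | head P => exact val_tape_ι₁ φ c P
  | tail W m ih =>
    exact (congrArg (val φ) (Category.assoc _ _ _).symm).trans
      ((val_comp_ι₂ φ (tape c ≫ m.inj)).trans (ih _))

theorem val_generator_some {U : C} (φ : TestFun U) (x : Σ V : C, Letter V Q × (U ⟶ V)) :
    val φ (generator U Q (some x)) = φ x.2.1.idx x.1 x.2.2 := val_tape_inj φ x.2.2 x.2.1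

/-- The position, letter and arrow that determine a generator different from `⋆`. -/
def generatorKey {U : C} (x : Σ V : C, Letter V Q × (U ⟶ V)) : ℕ × Σ V : C, (U ⟶ V) :=
  (x.2.1.idx, ⟨x.1, x.2.2⟩)

theorem generatorKey_injective {U : C} :
    Function.Injective (generatorKey (C := C) (Q := Q) (U := U)) := by
  rintro ⟨V, m, c⟩ ⟨V', m', c'⟩ h
  simp only [generatorKey, Prod.mk.injEq, Sigma.mk.injEq] at h
  obtain ⟨h, rfl, hc⟩ := h
  obtain rfl := eq_of_heq hc
  obtain rfl := Letter.idx_injective m m' h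
  rfl

open Classical in
/-- The affine functions dual to the generators: the probability of a generator `c ; ι`, and the
missing mass for the generator `⋆`. -/
def coord (U : C) (Q : Tape C) : Option (Σ V : C, Letter V Q × (U ⟶ V)) → (letter U ⟶ Q) → ℝ
  | none => fun f => 1 - val 1 f
  | some x => val fun n V c => if (n, ⟨V, c⟩) = generatorKey x then 1 else 0

theorem coord_isAffine {U : C} (i) : (homOps C (letter U) Q).IsAffine (coord U Q i) := by
  rcases i with _ | x
  · intro p f g
    simp only [coord]
    rw [val_isAffine]
    ring
  · exact val_isAffine _

open Classical in
theorem coord_generator {U : C} (i j) : coord U Q i (generator U Q j) = if j = i then 1 else 0 := by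
  rcases i with _ | x <;> rcases j with _ | y
  · simp [coord, generator, val_star]
  · simp [coord, val_generator_some]
  · simp [coord, generator, val_star]
  · simp only [coord, val_generator_some, Option.some_inj]
    exact if_congr generatorKey_injective.eq_iff rfl rfl

/-- One half. -/
def half : OpenUnit := ⟨1 / 2, by norm_num, by norm_num⟩

theorem half_compl : half.compl = half := OpenUnit.ext_val (by norm_num [half, OpenUnit.compl])

theorem half_cancel_letter {U : C} {f g : letter U ⟶ Q}
    (h : (homOps C (letter U) Q).conv half f (homOps C (letter U) Q).star =
      (homOps C (letter U) Q).conv half g (homOps C (letter U) Q).star) : f = g := by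
  classical
  refine PCAOps.Hull.eq_of_dual (isPCA _ _) coord_isAffine coord_generator
    (hull_generator f) (hull_generator g) fun i => ?_
  have h' := congrArg (coord U Q i) h
  rw [coord_isAffine i, coord_isAffine i] at h'
  simpa [half] using h'

theorem half_conv_comp {f g : Q ⟶ R} (k : P ⟶ Q)
    (h : (homOps C Q R).conv half f (homOps C Q R).star =
      (homOps C Q R).conv half g (homOps C Q R).star) :
    (homOps C P R).conv half (k ≫ f) (homOps C P R).star =
      (homOps C P R).conv half (k ≫ g) (homOps C P R).star := by
  have e := congrArg (k ≫ ·) h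
  rwa [isPCAEnriched.comp_conv, isPCAEnriched.comp_conv, isPCAEnriched.comp_star] at e

/-- Homsets are cancellative, unlike arbitrary pointed convex algebras. -/
theorem half_cancel {f g : P ⟶ Q} (h : (homOps C P Q).conv half f (homOps C P Q).star =
    (homOps C P Q).conv half g (homOps C P Q).star) : f = g := by
  induction P using List.rec with
  | nil => exact hom_ext_zero_left f g
  | cons U P ih =>
    exact oplus_hom_ext (P := letter U) (Q := P) (half_cancel_letter (half_conv_comp _ h))
      (ih (half_conv_comp _ h))

/-! ### Convex products -/

/-- The projections are jointly monic: `½ · id = π₁ ; ι₁ +_{1/2} π₂ ; ι₂`, so `½ · h` is determined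
by the components of `h`, and scalars can be cancelled. -/
theorem hom_ext_π {f g : R ⟶ oplus P Q} (h₁ : f ≫ π₁ P Q = g ≫ π₁ P Q)
    (h₂ : f ≫ π₂ P Q = g ≫ π₂ P Q) : f = g := by
  have key : (homOps C _ _).conv half (𝟙 (oplus P Q)) (homOps C _ _).star =
      (homOps C _ _).conv half (π₁ P Q ≫ ι₁ P Q) (π₂ P Q ≫ ι₂ P Q) := by
    have hs : ∀ {S T : Tape C} (k : T ⟶ oplus P Q), (bang S ≫ cobang T) ≫ k =
        (homOps C S _).star := fun k => isPCAEnriched.star_comp _ k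
    apply oplus_hom_ext
    · rw [isPCAEnriched.comp_conv, isPCAEnriched.comp_conv, isPCAEnriched.comp_star,
        Category.comp_id, ← Category.assoc, ← Category.assoc, ι₁_π₁, Category.id_comp, ι₁_π₂, hs]
    · rw [isPCAEnriched.comp_conv, isPCAEnriched.comp_conv, isPCAEnriched.comp_star,
        Category.comp_id, ← Category.assoc, ← Category.assoc, ι₂_π₂, Category.id_comp, ι₂_π₁, hs,
        (isPCA _ _).comm, half_compl]
  have key' : ∀ k : R ⟶ oplus P Q, (homOps C _ _).conv half k (homOps C _ _).star =
      (homOps C _ _).conv half ((k ≫ π₁ P Q) ≫ ι₁ P Q) ((k ≫ π₂ P Q) ≫ ι₂ P Q) := by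
    intro k
    have := congrArg (k ≫ ·) key
    rwa [isPCAEnriched.comp_conv, isPCAEnriched.comp_conv, isPCAEnriched.comp_star,
      Category.comp_id, ← Category.assoc, ← Category.assoc] at this
  apply half_cancel
  rw [key', key', h₁, h₂]

theorem hom_ext_proj {n : ℕ} (Q : Fin n → Tape C) {f g : R ⟶ bigOplus Q}
    (h : ∀ i, f ≫ proj Q i = g ≫ proj Q i) : f = g := by
  induction n with
  | zero => exact hom_ext_zero_right f g
  | succ n ih =>
    apply hom_ext_π (h 0)
    apply ih
    intro i
    exact (Category.assoc _ _ _).trans ((h i.succ).trans (Category.assoc _ _ _).symm)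

theorem tailWeights_mem {n : ℕ} {p : Fin (n + 1) → ℝ} (hp : ∀ i, p i ∈ Set.Icc (0 : ℝ) 1)
    (hsum : ∑ i, p i ≤ 1) (i : Fin n) : tailWeights p i ∈ Set.Icc (0 : ℝ) 1 := by
  unfold tailWeights
  split_ifs with h
  · simp
  · have h0 : 0 < 1 - p 0 := sub_pos.mpr (lt_of_le_of_ne (hp 0).2 h)
    have hi : p i.succ ≤ ∑ j : Fin n, p j.succ :=
      Finset.single_le_sum (f := fun j : Fin n => p j.succ) (fun j _ => (hp j.succ).1)
        (Finset.mem_univ i)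
    rw [Fin.sum_univ_succ] at hsum
    exact ⟨div_nonneg (hp _).1 h0.le, (div_le_one h0).mpr (by linarith)⟩

theorem sum_tailWeights_le {n : ℕ} {p : Fin (n + 1) → ℝ} (hp : ∀ i, p i ∈ Set.Icc (0 : ℝ) 1)
    (hsum : ∑ i, p i ≤ 1) : ∑ i, tailWeights p i ≤ 1 := by
  unfold tailWeights
  split_ifs with h
  · simp
  · have h0 : 0 < 1 - p 0 := sub_pos.mpr (lt_of_le_of_ne (hp 0).2 h)
    rw [Fin.sum_univ_succ] at hsum
    rw [← Finset.sum_div, div_le_one h0]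
    linarith

theorem one_sub_mul_tailWeights {n : ℕ} {p : Fin (n + 1) → ℝ} (hp : ∀ i, p i ∈ Set.Icc (0 : ℝ) 1)
    (hsum : ∑ i, p i ≤ 1) (i : Fin n) : (1 - p 0) * tailWeights p i = p i.succ := by
  unfold tailWeights
  split_ifs with h
  · have hi : p i.succ ≤ ∑ j : Fin n, p j.succ :=
      Finset.single_le_sum (f := fun j : Fin n => p j.succ) (fun j _ => (hp j.succ).1)
        (Finset.mem_univ i)
    rw [Fin.sum_univ_succ] at hsum
    have := (hp i.succ).1
    linarith
  · have h0 : 1 - p 0 ≠ 0 := sub_ne_zero.mpr (Ne.symm h)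
    field_simp

theorem convI_star_comp {p : ℝ} (f : P ⟶ Q) (g : Q ⟶ R) :
    (homOps C P Q).convI p (homOps C P Q).star f ≫ g =
      (homOps C P R).convI p (homOps C P R).star (f ≫ g) := by
  unfold PCAOps.convI
  split_ifs
  · rw [isPCAEnriched.conv_comp, isPCAEnriched.star_comp]
  · rfl
  · exact isPCAEnriched.star_comp _ _

theorem diagN_bigSumHom_proj {n : ℕ} (p : Fin n → ℝ) (hp : ∀ i, p i ∈ Set.Icc (0 : ℝ) 1)
    (hsum : ∑ i, p i ≤ 1) (P : Tape C) (Q : Fin n → Tape C) (t : ∀ i, P ⟶ Q i) (i : Fin n) :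
    (diagN p P ≫ bigSumHom t) ≫ proj Q i = (homOps C P (Q i)).scale (p i) (t i) := by
  induction n with
  | zero => exact i.elim0
  | succ n ih =>
    have e : diagN p P ≫ bigSumHom t = diagI (p 0) P ≫
        sumHom (t 0) (diagN (tailWeights p) P ≫ bigSumHom fun i => t i.succ) := by
      refine (Category.assoc _ _ _).trans (congrArg (diagI (p 0) P ≫ ·) ?_)
      exact (sumHom_comp _ _ _ _).trans (congrArg (sumHom · _) (Category.id_comp _))
    refine Eq.trans (congrArg (· ≫ proj Q i) e) ?_
    cases i using Fin.cases with
    | zero => exact diagI_sumHom_π₁ _ _ _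
    | succ i =>
      change (diagI (p 0) P ≫ sumHom (t 0) _) ≫ π₂ _ _ ≫ proj (fun j => Q j.succ) i = _
      rw [← Category.assoc, diagI_sumHom_π₂, convI_star_comp,
        ih (tailWeights p) (tailWeights_mem hp hsum) (sum_tailWeights_le hp hsum),
        (isPCA _ _).convI_star_left (hp 0), (isPCA _ _).scale_scale _ (tailWeights_mem hp hsum i),
        one_sub_mul_tailWeights hp hsum]
      exact ⟨by linarith [(hp 0).2], by linarith [(hp 0).1]⟩

theorem isNaryConvexProduct {n : ℕ} (Q : Fin n → Tape C) :
    IsNaryConvexProduct (homOps C) (proj Q) := by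
  intro p hp hsum P t
  refine ⟨diagN p P ≫ bigSumHom t, diagN_bigSumHom_proj p hp hsum P Q t, fun h hh => ?_⟩
  apply hom_ext_proj Q
  intro i
  rw [hh i, diagN_bigSumHom_proj p hp hsum P Q t i]

theorem isConvexProduct (P Q : Tape C) : IsConvexProduct (homOps C) (π₁ P Q) (π₂ P Q) := by
  intro p₁ p₂ hp₁ hp₂ hsum A f g
  -- The weight of the second component after the `p₁`-diagonal. If `p₁ = 1`, then `p₂ = 0` and the
  -- junk value `p₂ / 0 = 0` is the right weight.
  have hq : (1 - p₁) * (p₂ / (1 - p₁)) = p₂ := by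
    rcases eq_or_ne (1 - p₁) 0 with h | h
    · rw [h, zero_mul]
      linarith [hp₂.1]
    · field_simp
  have hp : 1 - p₁ ∈ Set.Icc (0 : ℝ) 1 := ⟨by linarith [hp₁.2], by linarith [hp₁.1]⟩
  have hq' : p₂ / (1 - p₁) ∈ Set.Icc (0 : ℝ) 1 :=
    ⟨div_nonneg hp₂.1 hp.1, div_le_one_of_le₀ (by linarith) hp.1⟩
  have e₁ := diagI_sumHom_π₁ p₁ f ((homOps C A Q).scale (p₂ / (1 - p₁)) g)
  have e₂ := diagI_sumHom_π₂ p₁ f ((homOps C A Q).scale (p₂ / (1 - p₁)) g)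
  rw [(isPCA _ _).convI_star_left hp₁, (isPCA _ _).scale_scale hp hq', hq] at e₂
  exact ⟨_, ⟨e₁, e₂⟩, fun h hh => hom_ext_π (hh.1.trans e₁.symm) (hh.2.trans e₂.symm)⟩

theorem isConvexBiproductCategory (C : Type u) [Category.{v} C] :
    IsConvexBiproductCategory (convexBiproductData C) where
  enriched := isPCAEnriched
  isInitial := ⟨IsInitial.ofUniqueHom (fun Q => cobang Q) fun _ _ => hom_ext_zero_left _ _⟩
  isFinal := ⟨IsTerminal.ofUniqueHom (fun P => bang P) fun _ _ => hom_ext_zero_right _ _⟩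
  isCoproduct _ _ := ⟨BinaryCofan.IsColimit.mk _ (fun f g => sumHom f g ≫ codiag _)
    (fun f g => ι₁_desc f g) (fun f g => ι₂_desc f g)
    (fun f g _ h₁ h₂ => oplus_hom_ext (h₁.trans (ι₁_desc f g).symm) (h₂.trans (ι₂_desc f g).symm))⟩
  isConvexProduct := isConvexProduct
  ι₁_π₁ := ι₁_π₁
  ι₂_π₂ := ι₂_π₂
  ι₁_π₂ := ι₁_π₂
  ι₂_π₁ := ι₂_π₁

end Tape

end ProbTape

end

theorem mainTheorem2 (C : Type u) [Category.{v} C] :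
    ProbTape.IsConvexBiproductCategory (ProbTape.Tape.convexBiproductData C) ∧
      ∀ (n : ℕ) (Q : Fin n → ProbTape.Tape C),
        ∃ hQ : ProbTape.IsNaryConvexProduct (ProbTape.Tape.homOps C) (ProbTape.Tape.proj Q),
          ∀ (p : Fin n → ℝ) (hp : ∀ i, p i ∈ Set.Icc (0 : ℝ) 1) (hsum : ∑ i, p i ≤ 1)
            (P : ProbTape.Tape C) (t : ∀ i, P ⟶ Q i),
            hQ.pairing p hp hsum t =
              ProbTape.Tape.diagN p P ≫ ProbTape.Tape.bigSumHom t := by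
  refine ⟨ProbTape.Tape.isConvexBiproductCategory C, fun n Q =>
    ⟨ProbTape.Tape.isNaryConvexProduct Q, fun p hp hsum P t => ?_⟩⟩
  have h := ProbTape.Tape.isNaryConvexProduct Q p hp hsum P t
  exact h.unique h.choose_spec.1 (ProbTape.Tape.diagN_bigSumHom_proj p hp hsum P Q t)
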